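/- Let $r\ge 0$ be an integer and let $\mathcal X_r$ be the Banach space of analytic functions $f$ on the open unit disc with $f^{(r+1)}\in H^1$, normed by $$\|f\|_r=\sum_{j=0}^r|f^{(j)}(0)|+\int_{\mathbb T}|f^{(r+1)}|\,dm ,$$ where $m$ is normalized arclength on the unit circle $\mathbb T$ and the last term is the $H^1$-norm $\sup_{0\le\rho<1}\frac1{2\pi}\int_0^{2\pi}|f^{(r+1)}(\rho e^{i\theta})|\,d\theta$. Let $T=M_z$ be the bounded operator $(Tf)(z)=zf(z)$ on $\mathcal X_r$. For a bounded operator $S$ let $M_n^{(0)}(S)=S^n$ and, for $p\ge1$, $$M_n^{(p)}(S)=\frac{p}{(n+1)\cdots(n+p)}\sum_{j=0}^n\frac{(j+p-1)!}{j!}M_j^{(p-1)}(S)$$ be its Cesàro means, so that $M_n(S):=M_n^{(1)}(S)=\frac1{n+1}\sum_{j=0}^nS^j$. Then: (i) for every integer $p\ge 2$, $\displaystyle\sup_{n\ge1,\ |\lambda|=1}n^{-r}\|M_n^{(p)}(\lambda T)\|<\infty$; (ii) the sequence $\{n^{-r}M_n(T)\}_{n\ge1}$ is unbounded in operator norm;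 (iii) $\{n^{-r-1}T^n\}$ does not converge strongly to $0$, i.e. $n^{-r-1}T^nf\not\to0$ in $\mathcal X_r$ for some $f\in\mathcal X_r$. In particular, $T$ has no spectrum in $\{|\mu|>1\}$ and satisfies $$\sup_{|\mu|>1}\frac{(|\mu|-1)^{r+1}}{|\mu|^r}\|(T-\mu I)^{-1}\|<\infty ,$$ while $\|T^n\|\ne o(n^{r+1})$ as $n\to\infty$. So in the theorem that this resolvent condition implies $\|T^n\|=o(n^{r+1})$ whenever $\sigma(T)\cap\mathbb T$ has arclength measure zero, the measure-zero hypothesis cannot be dropped. -/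

import Mathlib

/-! ## Cesàro means of a bounded operator -/

/-- The Cesàro means `M_n^{(p)}(T)` of order `p` of a bounded operator `T`:
`M_n^{(0)}(T) = T^n` and, for `p ≥ 1`,
`M_n^{(p)}(T) = p / ((n+1)⋯(n+p)) * ∑_{j=0}^n (j+p-1)!/j! • M_j^{(p-1)}(T)`.
The recursion is on the order, so it is written with `p + 1` in place of `p`. -/
noncomputable def cesaroMean {X : Type*} [NormedAddCommGroup X] [NormedSpace ℂ X]
    (T : X →L[ℂ] X) : ℕ → ℕ → (X →L[ℂ] X)
  | 0, n => T ^ n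
  | p + 1, n =>
      (((p : ℂ) + 1) / ∏ k ∈ Finset.range (p + 1), ((n : ℂ) + (k : ℂ) + 1)) •
        ∑ j ∈ Finset.range (n + 1),
          ((Nat.factorial (j + p) : ℂ) / (Nat.factorial j : ℂ)) • cesaroMean T p j

/-- Means of order one are the usual Cesàro means `(T^0 + ⋯ + T^n) / (n + 1)`. -/
theorem cesaroMean_one {X : Type*} [NormedAddCommGroup X] [NormedSpace ℂ X]
    (T : X →L[ℂ] X) (n : ℕ) :
    cesaroMean T 1 n = ((n : ℂ) + 1)⁻¹ • ∑ j ∈ Finset.range (n + 1), T ^ j := by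
  have h : ∀ j : ℕ, (Nat.factorial j : ℂ) / (Nat.factorial j : ℂ) = 1 := fun j =>
    div_self (Nat.cast_ne_zero.mpr (Nat.factorial_ne_zero j))
  simp [cesaroMean, h]

/-! ## The Hardy space `H¹` of the unit disc -/

namespace DiscHardy

open Metric Set Filter Topology

/-- The integral mean `M₁(g, ρ) = (2π)⁻¹ ∫_0^{2π} |g(ρ e^{iθ})| dθ`. -/
noncomputable def mean (g : ℂ → ℂ) (ρ : ℝ) : ℝ :=
  Real.circleAverage (fun z => ‖g z‖) 0 ρ

/-- `g` belongs (on the open unit disc) to the Hardy space `H¹`: it is holomorphic there and its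
integral means over the circles of radius `ρ < 1` are bounded. -/
def MemH1 (g : ℂ → ℂ) : Prop :=
  DifferentiableOn ℂ g (ball 0 1) ∧ ∃ C : ℝ, ∀ ρ ∈ Ico (0 : ℝ) 1, mean g ρ ≤ C

/-- The norm of `H¹`, i.e. `sup_{0 ≤ ρ < 1} M₁(g, ρ)`, which for `g ∈ H¹` is the integral of `|g|`
over the unit circle against normalized arclength. -/
noncomputable def h1Norm (g : ℂ → ℂ) : ℝ :=
  ⨆ ρ : Ico (0 : ℝ) 1, mean g ρ

theorem sphere_sub {ρ : ℝ} (hρ : ρ ∈ Ico (0 : ℝ) 1) : sphere (0 : ℂ) |ρ| ⊆ ball 0 1 := by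
  rw [abs_of_nonneg hρ.1]
  exact sphere_subset_ball hρ.2

theorem integrable_norm {g : ℂ → ℂ} (hg : DifferentiableOn ℂ g (ball 0 1)) {ρ : ℝ}
    (hρ : ρ ∈ Ico (0 : ℝ) 1) : CircleIntegrable (fun z => ‖g z‖) 0 ρ :=
  ContinuousOn.circleIntegrable' (hg.continuousOn.norm.mono (sphere_sub hρ))

theorem mean_nonneg (g : ℂ → ℂ) (ρ : ℝ) : 0 ≤ mean g ρ :=
  Real.circleAverage_nonneg_of_nonneg fun _ _ => norm_nonneg _

theorem mean_congr {g h : ℂ → ℂ} (hgh : EqOn g h (ball 0 1)) {ρ : ℝ}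
    (hρ : ρ ∈ Ico (0 : ℝ) 1) : mean g ρ = mean h ρ :=
  Real.circleAverage_congr_sphere fun z hz => by simp only [hgh (sphere_sub hρ hz)]

theorem MemH1.congr {g h : ℂ → ℂ} (hgh : EqOn g h (ball 0 1)) (hg : MemH1 g) : MemH1 h := by
  obtain ⟨hd, C, hC⟩ := hg
  exact ⟨hd.congr fun z hz => (hgh hz).symm, C, fun ρ hρ => mean_congr hgh hρ ▸ hC ρ hρ⟩

theorem h1Norm_congr {g h : ℂ → ℂ} (hgh : EqOn g h (ball 0 1)) : h1Norm g = h1Norm h :=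
  iSup_congr fun ρ => mean_congr hgh ρ.2

theorem mean_le_h1Norm {g : ℂ → ℂ} (hg : MemH1 g) {ρ : ℝ} (hρ : ρ ∈ Ico (0 : ℝ) 1) :
    mean g ρ ≤ h1Norm g := by
  obtain ⟨-, C, hC⟩ := hg
  exact le_ciSup (f := fun ρ : Ico (0 : ℝ) 1 => mean g ρ)
    ⟨C, by rintro _ ⟨x, rfl⟩; exact hC x x.2⟩ ⟨ρ, hρ⟩

theorem h1Norm_le {g : ℂ → ℂ} {C : ℝ} (h : ∀ ρ ∈ Ico (0 : ℝ) 1, mean g ρ ≤ C) :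
    h1Norm g ≤ C := by
  have : Nonempty (Ico (0 : ℝ) 1) := ⟨⟨0, by simp⟩⟩
  exact ciSup_le fun ρ => h ρ ρ.2

theorem h1Norm_nonneg (g : ℂ → ℂ) : 0 ≤ h1Norm g :=
  Real.iSup_nonneg fun _ => mean_nonneg _ _

theorem mean_add_le {g h : ℂ → ℂ} (hg : DifferentiableOn ℂ g (ball 0 1))
    (hh : DifferentiableOn ℂ h (ball 0 1)) {ρ : ℝ} (hρ : ρ ∈ Ico (0 : ℝ) 1) :
    mean (g + h) ρ ≤ mean g ρ + mean h ρ := by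
  unfold mean
  rw [← Real.circleAverage_fun_add (integrable_norm hg hρ) (integrable_norm hh hρ)]
  exact Real.circleAverage_mono (integrable_norm (hg.add hh) hρ)
    ((integrable_norm hg hρ).add (integrable_norm hh hρ)) fun z _ => norm_add_le _ _

theorem mean_smul (c : ℂ) (g : ℂ → ℂ) (ρ : ℝ) : mean (c • g) ρ = ‖c‖ * mean g ρ := by
  unfold mean
  rw [← smul_eq_mul, ← Real.circleAverage_fun_smul]
  simp

theorem MemH1.add {g h : ℂ → ℂ} (hg : MemH1 g) (hh : MemH1 h) : MemH1 (g + h) :=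
  ⟨hg.1.add hh.1, h1Norm g + h1Norm h, fun _ hρ => (mean_add_le hg.1 hh.1 hρ).trans
    (add_le_add (mean_le_h1Norm hg hρ) (mean_le_h1Norm hh hρ))⟩

theorem MemH1.smul (c : ℂ) {g : ℂ → ℂ} (hg : MemH1 g) : MemH1 (c • g) :=
  ⟨hg.1.const_smul c, ‖c‖ * h1Norm g, fun ρ hρ => by
    rw [mean_smul]
    exact mul_le_mul_of_nonneg_left (mean_le_h1Norm hg hρ) (norm_nonneg c)⟩

theorem MemH1.zero : MemH1 0 :=
  ⟨differentiableOn_const 0, 0, fun ρ _ => by simp [mean, Real.circleAverage]⟩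

theorem h1Norm_add_le {g h : ℂ → ℂ} (hg : MemH1 g) (hh : MemH1 h) :
    h1Norm (g + h) ≤ h1Norm g + h1Norm h :=
  h1Norm_le fun _ hρ => (mean_add_le hg.1 hh.1 hρ).trans
    (add_le_add (mean_le_h1Norm hg hρ) (mean_le_h1Norm hh hρ))

theorem h1Norm_smul (c : ℂ) (g : ℂ → ℂ) : h1Norm (c • g) = ‖c‖ * h1Norm g := by
  unfold h1Norm
  rw [Real.mul_iSup_of_nonneg (norm_nonneg c)]
  exact iSup_congr fun ρ => mean_smul c g ρ

/-- Point evaluations are controlled by the `H¹` norm. -/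
theorem norm_le_h1Norm {g : ℂ → ℂ} (hg : MemH1 g) {z : ℂ} (hz : z ∈ ball (0 : ℂ) 1) :
    ‖g z‖ ≤ 2 / (1 - ‖z‖) * h1Norm g := by
  have hz1 : ‖z‖ < 1 := by simpa using hz
  have hz0 := norm_nonneg z
  set ρ : ℝ := (1 + ‖z‖) / 2 with hρdef
  have hρ : ρ ∈ Ico (0 : ℝ) 1 := ⟨by linarith, by linarith⟩
  have hρabs : |ρ| = ρ := abs_of_nonneg hρ.1
  have hzρ : ‖z‖ < ρ := by linarith
  have hsub : closedBall (0 : ℂ) ρ ⊆ ball 0 1 := closedBall_subset_ball hρ.2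
  have hdc : DiffContOnCl ℂ g (ball 0 |ρ|) := by
    rw [hρabs]
    exact DifferentiableOn.diffContOnCl
      (hg.1.mono ((closure_ball_subset_closedBall).trans hsub))
  have key := hdc.circleAverage_smul_div (w := z) (by rw [hρabs]; simpa using hzρ)
  have hdiff : 0 < ρ - ‖z‖ := by linarith
  have hb : ∀ w ∈ sphere (0 : ℂ) |ρ|, ‖((w - 0) / (w - z)) • g w‖ ≤ (2 / (1 - ‖z‖)) * ‖g w‖ := by
    intro w hw
    have hw' : ‖w‖ = ρ := by rw [hρabs] at hw; simpa using hw
    have h1 : ρ - ‖z‖ ≤ ‖w - z‖ := by rw [← hw']; exact norm_sub_norm_le w z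
    rw [norm_smul, norm_div, sub_zero, hw']
    refine mul_le_mul_of_nonneg_right ?_ (norm_nonneg _)
    refine (div_le_div_of_nonneg_left hρ.1 hdiff h1).trans ?_
    rw [div_le_div_iff₀ hdiff (by linarith)]
    nlinarith [hρ.2]
  have hci : CircleIntegrable (fun w => ‖((w - 0) / (w - z)) • g w‖) 0 ρ := by
    apply ContinuousOn.circleIntegrable'
    apply ContinuousOn.norm
    refine ContinuousOn.fun_smul ?_ (hg.1.continuousOn.mono (sphere_sub hρ))
    apply ContinuousOn.div (by fun_prop) (by fun_prop)
    intro w hw h0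
    have hw' : ‖w‖ = ρ := by rw [hρabs] at hw; simpa using hw
    rw [sub_eq_zero.mp h0] at hw'
    linarith
  calc ‖g z‖ = ‖Real.circleAverage (fun w => ((w - 0) / (w - z)) • g w) 0 ρ‖ := by rw [key]
    _ ≤ Real.circleAverage (fun w => ‖((w - 0) / (w - z)) • g w‖) 0 ρ := by
        unfold Real.circleAverage
        rw [norm_smul, smul_eq_mul, Real.norm_of_nonneg (by positivity)]
        gcongr
        exact intervalIntegral.norm_integral_le_integral_norm (by positivity)
    _ ≤ Real.circleAverage (fun w => (2 / (1 - ‖z‖)) • ‖g w‖) 0 ρ :=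
        Real.circleAverage_mono hci ((integrable_norm hg.1 hρ).const_fun_smul) hb
    _ = 2 / (1 - ‖z‖) * mean g ρ := by
        rw [Real.circleAverage_fun_smul, smul_eq_mul]; rfl
    _ ≤ 2 / (1 - ‖z‖) * h1Norm g := by
        have : 0 < 1 - ‖z‖ := by linarith
        gcongr
        exact mean_le_h1Norm hg hρ

theorem differentiableOn_iteratedDeriv {f : ℂ → ℂ} (hf : DifferentiableOn ℂ f (ball 0 1)) (k : ℕ) :
    DifferentiableOn ℂ (iteratedDeriv k f) (ball 0 1) := by
  rw [iteratedDeriv_eq_iterate]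
  exact ((hf.analyticOnNhd isOpen_ball).iterated_deriv k).differentiableOn

theorem contDiffAt {f : ℂ → ℂ} (hf : DifferentiableOn ℂ f (ball 0 1)) {z : ℂ}
    (hz : z ∈ ball (0 : ℂ) 1) (k : ℕ) : ContDiffAt ℂ k f z :=
  (hf.analyticOnNhd isOpen_ball z hz).contDiffAt

theorem iteratedDeriv_add_eqOn {f g : ℂ → ℂ} (hf : DifferentiableOn ℂ f (ball 0 1))
    (hg : DifferentiableOn ℂ g (ball 0 1)) (k : ℕ) :
    EqOn (iteratedDeriv k (f + g)) (iteratedDeriv k f + iteratedDeriv k g) (ball 0 1) :=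
  fun _ hz => iteratedDeriv_add (contDiffAt hf hz k) (contDiffAt hg hz k)

theorem iteratedDeriv_smul_eq (c : ℂ) (f : ℂ → ℂ) (k : ℕ) :
    iteratedDeriv k (c • f) = c • iteratedDeriv k f := by
  ext z
  exact iteratedDeriv_const_smul_field c f

/-- A primitive of an `H¹` function is in `H¹`. -/
theorem mean_le_of_deriv {h : ℂ → ℂ} (hh : DifferentiableOn ℂ h (ball 0 1))
    (hd : MemH1 (deriv h)) {ρ : ℝ} (hρ : ρ ∈ Ico (0 : ℝ) 1) :
    mean h ρ ≤ ‖h 0‖ + h1Norm (deriv h) := by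
  have hmem : ∀ t ∈ Icc (0 : ℝ) 1, ∀ θ : ℝ, circleMap 0 (t * ρ) θ ∈ ball (0 : ℂ) 1 := by
    intro t ht θ
    have h0 : 0 ≤ t * ρ := mul_nonneg ht.1 hρ.1
    have : t * ρ < 1 := lt_of_le_of_lt (mul_le_of_le_one_left hρ.1 ht.2) hρ.2
    simpa [abs_of_nonneg ht.1, abs_of_nonneg hρ.1] using this
  have hcd : ContinuousOn (deriv h) (ball 0 1) := hd.1.continuousOn
  -- pointwise estimate
  have hpt : ∀ θ : ℝ, ‖h (circleMap 0 ρ θ)‖ ≤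
      ‖h 0‖ + ∫ t in (0 : ℝ)..1, ‖deriv h (circleMap 0 (t * ρ) θ)‖ := by
    intro θ
    have hcont : ContinuousOn (fun t : ℝ => deriv h (circleMap 0 (t * ρ) θ) *
        (ρ * Complex.exp (θ * Complex.I))) (uIcc 0 1) := by
      rw [uIcc_of_le zero_le_one]
      refine ContinuousOn.mul (hcd.comp ?_ fun t ht => hmem t ht θ) continuousOn_const
      unfold circleMap; fun_prop
    have hder : ∀ t ∈ uIcc (0 : ℝ) 1, HasDerivAt (fun t : ℝ => h (circleMap 0 (t * ρ) θ))
        (deriv h (circleMap 0 (t * ρ) θ) * (ρ * Complex.exp (θ * Complex.I))) t := by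
      intro t ht
      rw [uIcc_of_le zero_le_one] at ht
      have h1 := (hh.differentiableAt (isOpen_ball.mem_nhds (hmem t ht θ))).hasDerivAt
      have h2 : HasDerivAt (fun t : ℝ => circleMap 0 (t * ρ) θ)
          (ρ * Complex.exp (θ * Complex.I)) t := by
        have h3 : HasDerivAt (fun t : ℝ => (t : ℂ)) 1 t := Complex.ofRealCLM.hasDerivAt
        have h4 := h3.mul_const ((ρ : ℂ) * Complex.exp (θ * Complex.I))
        rw [one_mul] at h4
        refine h4.congr_of_eventuallyEq (Eventually.of_forall fun s => ?_)
        simp [circleMap, mul_assoc]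
      exact h1.comp t h2
    have hint := intervalIntegral.integral_eq_sub_of_hasDerivAt hder hcont.intervalIntegrable
    have e1 : circleMap 0 (1 * ρ) θ = circleMap 0 ρ θ := by rw [one_mul]
    have e0 : circleMap 0 (0 * ρ) θ = 0 := by simp [circleMap]
    rw [e1, e0] at hint
    have : h (circleMap 0 ρ θ) = h 0 + ∫ t in (0 : ℝ)..1,
        deriv h (circleMap 0 (t * ρ) θ) * (ρ * Complex.exp (θ * Complex.I)) := by
      rw [hint]; ring
    rw [this]
    refine (norm_add_le _ _).trans (add_le_add le_rfl ?_)
    refine (intervalIntegral.norm_integral_le_integral_norm zero_le_one).trans ?_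
    refine intervalIntegral.integral_mono_on zero_le_one hcont.norm.intervalIntegrable ?_ ?_
    · apply ContinuousOn.intervalIntegrable
      rw [uIcc_of_le zero_le_one]
      refine (hcd.comp ?_ fun t ht => hmem t ht θ).norm
      unfold circleMap; fun_prop
    · intro t _
      rw [norm_mul, norm_mul, Complex.norm_exp_ofReal_mul_I, mul_one, Complex.norm_real,
        Real.norm_of_nonneg hρ.1]
      exact mul_le_of_le_one_right (norm_nonneg _) hρ.2.le
  -- integrate over the circle
  have hF : ContinuousOn (Function.uncurry fun (t θ : ℝ) => ‖deriv h (circleMap 0 (t * ρ) θ)‖)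
      (Icc 0 1 ×ˢ univ) := by
    refine (hcd.comp (t := ball (0 : ℂ) 1)
      (f := fun x : ℝ × ℝ => circleMap 0 (x.1 * ρ) x.2) ?_ fun x hx => hmem x.1 hx.1 x.2).norm
    unfold circleMap; fun_prop
  have hFi : MeasureTheory.Integrable
      (Function.uncurry fun (t θ : ℝ) => ‖deriv h (circleMap 0 (t * ρ) θ)‖)
      ((MeasureTheory.volume.restrict (uIoc 0 1)).prod
        (MeasureTheory.volume.restrict (uIoc 0 (2 * Real.pi)))) := by
    rw [MeasureTheory.Measure.prod_restrict, uIoc_of_le zero_le_one,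
      uIoc_of_le Real.two_pi_pos.le]
    have : MeasureTheory.IntegrableOn
      (Function.uncurry fun (t θ : ℝ) => ‖deriv h (circleMap 0 (t * ρ) θ)‖)
      (Icc 0 1 ×ˢ Icc 0 (2 * Real.pi)) (MeasureTheory.volume.prod MeasureTheory.volume) :=
      ContinuousOn.integrableOn_compact (isCompact_Icc.prod isCompact_Icc)
        (hF.mono (prod_mono le_rfl (subset_univ _)))
    exact this.mono_set (prod_mono Ioc_subset_Icc_self Ioc_subset_Icc_self)
  have hswap := MeasureTheory.intervalIntegral_intervalIntegral_swap
    (F := fun (t θ : ℝ) => ‖deriv h (circleMap 0 (t * ρ) θ)‖) (a := 0) (b := 1) (c := 0)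
    (d := 2 * Real.pi) (by
      rw [MeasureTheory.Measure.prod_restrict] at hFi
      exact hFi)
  have hFθ : IntervalIntegrable (fun θ => ∫ t in (0 : ℝ)..1,
      ‖deriv h (circleMap 0 (t * ρ) θ)‖) MeasureTheory.volume 0 (2 * Real.pi) := by
    rw [intervalIntegrable_iff]
    have := hFi.integral_prod_right
    refine this.congr (Eventually.of_forall fun θ => ?_)
    simp only [Function.uncurry, intervalIntegral.integral_of_le zero_le_one,
      uIoc_of_le (zero_le_one (α := ℝ))]
  have hmain : (∫ θ in (0 : ℝ)..2 * Real.pi, ‖h (circleMap 0 ρ θ)‖) ≤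
      2 * Real.pi * (‖h 0‖ + h1Norm (deriv h)) := by
    calc (∫ θ in (0 : ℝ)..2 * Real.pi, ‖h (circleMap 0 ρ θ)‖)
        ≤ ∫ θ in (0 : ℝ)..2 * Real.pi,
          (‖h 0‖ + ∫ t in (0 : ℝ)..1, ‖deriv h (circleMap 0 (t * ρ) θ)‖) :=
          intervalIntegral.integral_mono_on Real.two_pi_pos.le (integrable_norm hh hρ)
            (intervalIntegrable_const.add hFθ) fun θ _ => hpt θ
      _ = 2 * Real.pi * ‖h 0‖ + ∫ t in (0 : ℝ)..1, ∫ θ in (0 : ℝ)..2 * Real.pi,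
            ‖deriv h (circleMap 0 (t * ρ) θ)‖ := by
          rw [intervalIntegral.integral_add intervalIntegrable_const hFθ, hswap]
          simp
      _ ≤ 2 * Real.pi * ‖h 0‖ + ∫ _t in (0 : ℝ)..1, 2 * Real.pi * h1Norm (deriv h) := by
          refine add_le_add le_rfl ?_
          refine intervalIntegral.integral_mono_on zero_le_one ?_ intervalIntegrable_const ?_
          · rw [intervalIntegrable_iff]
            refine hFi.integral_prod_left.congr (Eventually.of_forall fun t => ?_)
            simp only [Function.uncurry, intervalIntegral.integral_of_le Real.two_pi_pos.le,
              uIoc_of_le Real.two_pi_pos.le]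
          · intro t ht
            have htρ : t * ρ ∈ Ico (0 : ℝ) 1 :=
              ⟨mul_nonneg ht.1 hρ.1,
                lt_of_le_of_lt (mul_le_of_le_one_left hρ.1 ht.2) hρ.2⟩
            have := mean_le_h1Norm hd htρ
            unfold mean Real.circleAverage at this
            rw [smul_eq_mul, inv_mul_le_iff₀ Real.two_pi_pos] at this
            exact this
      _ = 2 * Real.pi * (‖h 0‖ + h1Norm (deriv h)) := by
          simp; ring
  unfold mean Real.circleAverage
  rw [smul_eq_mul, inv_mul_le_iff₀ Real.two_pi_pos]
  exact hmain

end DiscHardy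

/-! ## The space `X_r` and the operator `M_z` -/

namespace ShieldsSpace

open Metric Set Filter Topology DiscHardy

/-- The vector space of holomorphic functions `f` on the open unit disc with `f^{(r+1)} ∈ H¹`.
A function on the disc is represented by its extension by `0` to the whole plane. -/
def submodule (r : ℕ) : Submodule ℂ (ℂ → ℂ) where
  carrier := {f | DifferentiableOn ℂ f (ball 0 1) ∧ (∀ z ∉ ball (0 : ℂ) 1, f z = 0) ∧
    MemH1 (iteratedDeriv (r + 1) f)}
  add_mem' := by
    rintro f g ⟨hf, hf0, hf1⟩ ⟨hg, hg0, hg1⟩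
    exact ⟨hf.add hg, fun z hz => by simp [hf0 z hz, hg0 z hz],
      (hf1.add hg1).congr (iteratedDeriv_add_eqOn hf hg _).symm⟩
  zero_mem' := by
    refine ⟨differentiableOn_const 0, fun _ _ => rfl, ?_⟩
    have h := iteratedDeriv_smul_eq 0 0 (r + 1)
    rw [zero_smul, zero_smul] at h
    rw [h]
    exact MemH1.zero
  smul_mem' := by
    rintro c f ⟨hf, hf0, hf1⟩
    refine ⟨hf.const_smul c, fun z hz => by simp [hf0 z hz], ?_⟩
    rw [iteratedDeriv_smul_eq]
    exact hf1.smul c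

end ShieldsSpace

/-- The space `X_r` of analytic functions `f` on the unit disc with `f^{(r+1)} ∈ H¹`. -/
def ShieldsSpace (r : ℕ) : Type := ShieldsSpace.submodule r

namespace ShieldsSpace

open Metric Set Filter Topology DiscHardy

variable {r : ℕ}

noncomputable instance : AddCommGroup (ShieldsSpace r) :=
  inferInstanceAs (AddCommGroup (submodule r))

noncomputable instance : Module ℂ (ShieldsSpace r) :=
  inferInstanceAs (Module ℂ (submodule r))

/-- The function represented by an element of `X_r`. -/
def toFun (f : ShieldsSpace r) : ℂ → ℂ := Subtype.val f

instance : CoeFun (ShieldsSpace r) (fun _ => ℂ → ℂ) := ⟨toFun⟩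

theorem differentiableOn (f : ShieldsSpace r) : DifferentiableOn ℂ f (ball 0 1) := f.2.1

theorem eq_zero_of_notMem (f : ShieldsSpace r) {z : ℂ} (hz : z ∉ ball (0 : ℂ) 1) : f z = 0 :=
  f.2.2.1 z hz

theorem memH1 (f : ShieldsSpace r) : MemH1 (iteratedDeriv (r + 1) f) := f.2.2.2

theorem coe_add (f g : ShieldsSpace r) : (f + g : ShieldsSpace r).toFun = f.toFun + g.toFun := rfl

theorem coe_sub (f g : ShieldsSpace r) : (f - g : ShieldsSpace r).toFun = f.toFun - g.toFun := rfl

theorem coe_smul (c : ℂ) (f : ShieldsSpace r) : (c • f : ShieldsSpace r).toFun = c • f.toFun := rfl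

theorem coe_zero : (0 : ShieldsSpace r).toFun = 0 := rfl

theorem ext_ball {f g : ShieldsSpace r} (h : EqOn f g (ball 0 1)) : f = g := by
  apply Subtype.ext
  funext z
  by_cases hz : z ∈ ball (0 : ℂ) 1
  · exact h hz
  · exact (f.eq_zero_of_notMem hz).trans (g.eq_zero_of_notMem hz).symm

/-- The norm `‖f‖_r = ∑_{j=0}^r |f^{(j)}(0)| + ‖f^{(r+1)}‖_{H¹}`. -/
noncomputable instance : Norm (ShieldsSpace r) where
  norm f := ∑ j ∈ Finset.range (r + 1), ‖iteratedDeriv j f 0‖ + h1Norm (iteratedDeriv (r + 1) f)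

theorem norm_def (f : ShieldsSpace r) :
    ‖f‖ = ∑ j ∈ Finset.range (r + 1), ‖iteratedDeriv j f 0‖ + h1Norm (iteratedDeriv (r + 1) f) :=
  rfl

theorem norm_nonneg' (f : ShieldsSpace r) : 0 ≤ ‖f‖ :=
  add_nonneg (Finset.sum_nonneg fun _ _ => norm_nonneg _) (h1Norm_nonneg _)

theorem h1Norm_le_norm (f : ShieldsSpace r) : h1Norm (iteratedDeriv (r + 1) f) ≤ ‖f‖ :=
  le_add_of_nonneg_left (Finset.sum_nonneg fun _ _ => norm_nonneg _)

theorem iteratedDeriv_zero_le_norm (f : ShieldsSpace r) {j : ℕ} (hj : j ≤ r) :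
    ‖iteratedDeriv j f 0‖ ≤ ‖f‖ :=
  (Finset.single_le_sum (f := fun j => ‖iteratedDeriv j f 0‖) (fun _ _ => norm_nonneg _)
    (Finset.mem_range.mpr (Nat.lt_succ_of_le hj))).trans
    (le_add_of_nonneg_right (h1Norm_nonneg _))

/-- On each smaller disc, all derivatives up to order `r + 1` are controlled by the norm. -/
theorem exists_bound (r : ℕ) {s : ℝ} (hs0 : 0 ≤ s) (hs : s < 1) (k : ℕ) (hk : k ≤ r + 1) :
    ∃ K : ℝ, ∀ f : ShieldsSpace r, ∀ z : ℂ, ‖z‖ ≤ s →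
      ‖iteratedDeriv (r + 1 - k) f z‖ ≤ K * ‖f‖ := by
  have h1s : 0 < 1 - s := by linarith
  induction k with
  | zero =>
    refine ⟨2 / (1 - s), fun f z hz => ?_⟩
    have hz1 : z ∈ ball (0 : ℂ) 1 := by simpa using hz.trans_lt hs
    refine (norm_le_h1Norm f.memH1 hz1).trans ?_
    have := f.h1Norm_le_norm
    have h0 := h1Norm_nonneg (iteratedDeriv (r + 1) f)
    gcongr
  | succ k ih =>
    obtain ⟨K, hK⟩ := ih (by omega)
    refine ⟨1 + K * s, fun f z hz => ?_⟩
    have hsub : closedBall (0 : ℂ) s ⊆ ball 0 1 := closedBall_subset_ball hs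
    have hidx : r + 1 - k = (r + 1 - (k + 1)) + 1 := by omega
    have hd := differentiableOn_iteratedDeriv f.differentiableOn (r + 1 - (k + 1))
    have hKf : 0 ≤ K * ‖f‖ := (norm_nonneg _).trans (hK f 0 (by simpa using hs0))
    have := (convex_closedBall (0 : ℂ) s).norm_image_sub_le_of_norm_deriv_le
      (f := iteratedDeriv (r + 1 - (k + 1)) f) (C := K * ‖f‖) (x := 0) (y := z)
      (fun x hx => hd.differentiableAt (isOpen_ball.mem_nhds (hsub hx)))
      (fun x hx => by
        rw [← iteratedDeriv_succ, ← hidx]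
        exact hK f x (by simpa using hx))
      (by simpa using hs0) (by simpa using hz)
    rw [sub_zero] at this
    have h0 := f.iteratedDeriv_zero_le_norm (j := r + 1 - (k + 1)) (by omega)
    have h2 := norm_le_insert' (iteratedDeriv (r + 1 - (k + 1)) f z)
      (iteratedDeriv (r + 1 - (k + 1)) f 0)
    have h3 : K * ‖f‖ * ‖z‖ ≤ K * ‖f‖ * s := mul_le_mul_of_nonneg_left hz hKf
    linarith

theorem exists_bound_apply (r : ℕ) {s : ℝ} (hs0 : 0 ≤ s) (hs : s < 1) :
    ∃ K : ℝ, ∀ f : ShieldsSpace r, ∀ z : ℂ, ‖z‖ ≤ s → ‖f z‖ ≤ K * ‖f‖ := by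
  obtain ⟨K, hK⟩ := exists_bound r hs0 hs (r + 1) le_rfl
  exact ⟨K, fun f z hz => by simpa using hK f z hz⟩

theorem core (r : ℕ) : NormedSpace.Core ℂ (ShieldsSpace r) where
  norm_nonneg := norm_nonneg'
  norm_smul c f := by
    simp only [norm_def, coe_smul, iteratedDeriv_smul_eq, h1Norm_smul, Pi.smul_apply, norm_smul,
      mul_add, Finset.mul_sum]
  norm_triangle f g := by
    have h0 : (0 : ℂ) ∈ ball (0 : ℂ) 1 := by simp
    have e := iteratedDeriv_add_eqOn f.differentiableOn g.differentiableOn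
    simp only [norm_def, coe_add]
    rw [h1Norm_congr (e (r + 1))]
    have h1 := h1Norm_add_le f.memH1 g.memH1
    have h2 : ∑ j ∈ Finset.range (r + 1), ‖iteratedDeriv j (f.toFun + g.toFun) 0‖ ≤
        ∑ j ∈ Finset.range (r + 1), ‖iteratedDeriv j f 0‖ +
          ∑ j ∈ Finset.range (r + 1), ‖iteratedDeriv j g 0‖ := by
      rw [← Finset.sum_add_distrib]
      refine Finset.sum_le_sum fun j _ => ?_
      rw [e j h0]
      exact norm_add_le _ _
    linarith
  norm_eq_zero_iff f := by
    constructor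
    · intro h
      apply ext_ball
      intro z hz
      obtain ⟨K, hK⟩ := exists_bound_apply r (norm_nonneg z) (by simpa using hz : ‖z‖ < 1)
      have := hK f z le_rfl
      rw [h, mul_zero] at this
      simpa [coe_zero] using norm_le_zero_iff.mp this
    · rintro rfl
      simp [norm_def, coe_zero, h1Norm, mean, Real.circleAverage]

noncomputable instance : NormedAddCommGroup (ShieldsSpace r) := NormedAddCommGroup.ofCore (core r)

noncomputable instance : NormedSpace ℂ (ShieldsSpace r) :=
  NormedSpace.ofCore (core r)

theorem tendstoLocallyUniformlyOn_iteratedDeriv {u : ℕ → ℂ → ℂ} {F : ℂ → ℂ}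
    (hu : ∀ n, DifferentiableOn ℂ (u n) (ball 0 1))
    (h : TendstoLocallyUniformlyOn u F atTop (ball 0 1)) (k : ℕ) :
    TendstoLocallyUniformlyOn (fun n => iteratedDeriv k (u n)) (iteratedDeriv k F) atTop
      (ball 0 1) := by
  induction k with
  | zero => simpa using h
  | succ k ih =>
    simp only [iteratedDeriv_succ]
    exact ih.deriv (Eventually.of_forall fun n => differentiableOn_iteratedDeriv (hu n) k)
      isOpen_ball

/-- `X_r` is a Banach space. -/
instance : CompleteSpace (ShieldsSpace r) := by
  refine Metric.complete_of_cauchySeq_tendsto fun u hu => ?_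
  have hC := Metric.cauchySeq_iff.mp hu
  -- locally uniform limit
  have hcs : ∀ z ∈ ball (0 : ℂ) 1, ∃ w, Tendsto (fun n => u n z) atTop (𝓝 w) := by
    intro z hz
    apply cauchySeq_tendsto_of_complete
    obtain ⟨K, hK⟩ := exists_bound_apply r (norm_nonneg z) (by simpa using hz : ‖z‖ < 1)
    rw [Metric.cauchySeq_iff]
    intro ε hε
    obtain ⟨N, hN⟩ := hC (ε / (|K| + 1)) (by positivity)
    refine ⟨N, fun m hm n hn => ?_⟩
    have h1 := hN m hm n hn
    rw [dist_eq_norm, lt_div_iff₀ (by positivity)] at h1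
    have h2 := hK (u m - u n) z le_rfl
    rw [coe_sub, Pi.sub_apply] at h2
    rw [dist_eq_norm]
    nlinarith [le_abs_self K, norm_nonneg (u m - u n)]
  classical
  choose! w hw using hcs
  let F : ℂ → ℂ := fun z => if z ∈ ball (0 : ℂ) 1 then w z else 0
  have hF : ∀ z ∈ ball (0 : ℂ) 1, Tendsto (fun n => u n z) atTop (𝓝 (F z)) := by
    intro z hz
    simpa only [F, if_pos hz] using hw z hz
  have hlu : TendstoLocallyUniformlyOn (fun n => (u n).toFun) F atTop (ball 0 1) := by
    rw [tendstoLocallyUniformlyOn_iff_forall_isCompact isOpen_ball]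
    intro S hS hSc
    obtain ⟨s, hs, hSs⟩ : ∃ s : ℝ, s < 1 ∧ S ⊆ closedBall (0 : ℂ) s := by
      obtain ⟨s, hs, h⟩ := exists_lt_subset_ball hSc.isClosed hS
      exact ⟨s, hs, h.trans ball_subset_closedBall⟩
    obtain ⟨K, hK⟩ := exists_bound_apply r (le_max_right s 0) (max_lt hs one_pos)
    apply UniformCauchySeqOn.tendstoUniformlyOn_of_tendsto _ fun z hz => hF z (hS hz)
    rw [Metric.uniformCauchySeqOn_iff]
    intro ε hε
    obtain ⟨N, hN⟩ := hC (ε / (|K| + 1)) (by positivity)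
    refine ⟨N, fun m hm n hn z hz => ?_⟩
    have h1 := hN m hm n hn
    rw [dist_eq_norm, lt_div_iff₀ (by positivity)] at h1
    have hz' : ‖z‖ ≤ max s 0 := le_max_of_le_left (by simpa using hSs hz)
    have h2 := hK (u m - u n) z hz'
    rw [coe_sub, Pi.sub_apply] at h2
    rw [dist_eq_norm]
    nlinarith [le_abs_self K, norm_nonneg (u m - u n)]
  have hFd : DifferentiableOn ℂ F (ball 0 1) :=
    hlu.differentiableOn (Eventually.of_forall fun n => (u n).differentiableOn) isOpen_ball
  have hlk := tendstoLocallyUniformlyOn_iteratedDeriv (fun n => (u n).differentiableOn) hlu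
  -- the means of the derivatives
  have hmean : ∀ ε : ℝ, ∀ N, (∀ m ≥ N, ∀ n ≥ N, dist (u m) (u n) < ε) → ∀ n ≥ N,
      ∀ ρ ∈ Ico (0 : ℝ) 1,
        mean (iteratedDeriv (r + 1) F - iteratedDeriv (r + 1) (u n)) ρ ≤ ε := by
    intro ε N hN n hn ρ hρ
    refine le_of_forall_pos_le_add fun δ hδ => ?_
    have hunif := (tendstoLocallyUniformlyOn_iff_forall_isCompact isOpen_ball).mp (hlk (r + 1))
      (sphere 0 |ρ|) (sphere_sub hρ) (isCompact_sphere _ _)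
    rw [Metric.tendstoUniformlyOn_iff] at hunif
    obtain ⟨m, hm1, hm2⟩ := ((hunif δ hδ).and (eventually_ge_atTop N)).exists
    have hDF := differentiableOn_iteratedDeriv hFd (r + 1)
    have hDn := differentiableOn_iteratedDeriv (u n).differentiableOn (r + 1)
    have e : EqOn (iteratedDeriv (r + 1) (u m - u n : ShieldsSpace r))
        (iteratedDeriv (r + 1) (u m) - iteratedDeriv (r + 1) (u n)) (ball 0 1) := fun z hz =>
      iteratedDeriv_sub (contDiffAt (u m).differentiableOn hz _)
        (contDiffAt (u n).differentiableOn hz _)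
    have h1 : mean (iteratedDeriv (r + 1) (u m - u n : ShieldsSpace r)) ρ ≤ ε :=
      (mean_le_h1Norm (u m - u n).memH1 hρ).trans
        ((h1Norm_le_norm _).trans (by rw [← dist_eq_norm]; exact (hN m hm2 n hn).le))
    have hci := integrable_norm (u m - u n).memH1.1 hρ
    calc mean (iteratedDeriv (r + 1) F - iteratedDeriv (r + 1) (u n)) ρ
        ≤ Real.circleAverage (fun z =>
            ‖iteratedDeriv (r + 1) (u m - u n : ShieldsSpace r) z‖ + δ) 0 ρ := by
          refine Real.circleAverage_mono (integrable_norm (hDF.sub hDn) hρ)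
            (hci.add (circleIntegrable_const δ 0 ρ)) fun z hz => ?_
          have h2 := hm1 z hz
          rw [dist_eq_norm] at h2
          rw [e (sphere_sub hρ hz), Pi.sub_apply, Pi.sub_apply]
          have h3 := norm_sub_le_norm_sub_add_norm_sub (iteratedDeriv (r + 1) F z)
            (iteratedDeriv (r + 1) (u m) z) (iteratedDeriv (r + 1) (u n) z)
          linarith
      _ = mean (iteratedDeriv (r + 1) (u m - u n : ShieldsSpace r)) ρ + δ := by
          rw [Real.circleAverage_fun_add hci (circleIntegrable_const δ 0 ρ),
            Real.circleAverage_const]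
          rfl
      _ ≤ ε + δ := by linarith
  have hFmem : F ∈ submodule r := by
    refine ⟨hFd, fun z hz => by simp only [F, if_neg hz], ?_⟩
    obtain ⟨N, hN⟩ := hC 1 one_pos
    have h1 : MemH1 (iteratedDeriv (r + 1) F - iteratedDeriv (r + 1) (u N)) :=
      ⟨(differentiableOn_iteratedDeriv hFd _).sub
        (differentiableOn_iteratedDeriv (u N).differentiableOn _), 1,
        hmean 1 N hN N le_rfl⟩
    have h2 := h1.add (u N).memH1
    rwa [sub_add_cancel] at h2
  let G : ShieldsSpace r := ⟨F, hFmem⟩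
  have hG : G.toFun = F := rfl
  refine ⟨G, ?_⟩
  have h0 : (0 : ℂ) ∈ ball (0 : ℂ) 1 := by simp
  have hsub : ∀ n k, EqOn (iteratedDeriv k (u n - G : ShieldsSpace r))
      (iteratedDeriv k (u n) - iteratedDeriv k F) (ball 0 1) := fun n k z hz =>
    iteratedDeriv_sub (contDiffAt (u n).differentiableOn hz _) (contDiffAt hFd hz _)
  rw [tendsto_iff_norm_sub_tendsto_zero]
  have hsum : Tendsto (fun n => ∑ j ∈ Finset.range (r + 1),
      ‖iteratedDeriv j (u n - G : ShieldsSpace r) 0‖) atTop (𝓝 (0 : ℝ)) := by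
    have h2 : (0 : ℝ) = ∑ _j ∈ Finset.range (r + 1), (0 : ℝ) := by simp
    rw [h2]
    refine tendsto_finsetSum _ fun j _ => ?_
    have h1 := (hlk j).tendsto_at h0
    rw [tendsto_iff_norm_sub_tendsto_zero] at h1
    refine h1.congr fun n => ?_
    rw [hsub n j h0, Pi.sub_apply]
  have hh : Tendsto (fun n => h1Norm (iteratedDeriv (r + 1) (u n - G : ShieldsSpace r))) atTop
      (𝓝 0) := by
    rw [Metric.tendsto_atTop]
    intro ε hε
    obtain ⟨N, hN⟩ := hC (ε / 2) (half_pos hε)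
    refine ⟨N, fun n hn => ?_⟩
    rw [Real.dist_0_eq_abs, abs_of_nonneg (h1Norm_nonneg _)]
    refine lt_of_le_of_lt (h1Norm_le fun ρ hρ => ?_) (half_lt_self hε)
    rw [mean_congr (hsub n (r + 1)) hρ]
    have h1 := hmean (ε / 2) N hN n hn ρ hρ
    rw [← neg_sub, ← neg_one_smul ℂ, mean_smul] at h1
    simpa using h1
  simpa [norm_def] using hsum.add hh

/-- The derivatives of `z f(z)`. -/
theorem iteratedDeriv_id_mul {f : ℂ → ℂ} (hf : DifferentiableOn ℂ f (ball 0 1)) (k : ℕ) :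
    EqOn (iteratedDeriv (k + 1) fun z => z * f z)
      (fun z => z * iteratedDeriv (k + 1) f z + ((k : ℂ) + 1) * iteratedDeriv k f z)
      (ball 0 1) := by
  induction k with
  | zero =>
    intro z hz
    have h := hf.differentiableAt (isOpen_ball.mem_nhds hz)
    simp only [zero_add, iteratedDeriv_one, iteratedDeriv_zero]
    rw [deriv_fun_mul differentiableAt_fun_id h]
    simp
    ring
  | succ k ih =>
    intro z hz
    rw [iteratedDeriv_succ]
    rw [(ih.eventuallyEq_of_mem (isOpen_ball.mem_nhds hz)).deriv_eq]
    have h1 := (differentiableOn_iteratedDeriv hf (k + 1)).differentiableAt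
      (isOpen_ball.mem_nhds hz)
    have h0 := (differentiableOn_iteratedDeriv hf k).differentiableAt
      (isOpen_ball.mem_nhds hz)
    rw [deriv_fun_add (differentiableAt_fun_id.fun_mul h1) (h0.const_mul _),
      deriv_fun_mul differentiableAt_fun_id h1, deriv_const_mul _ h0, ← iteratedDeriv_succ,
      ← iteratedDeriv_succ]
    simp
    ring

theorem mean_iteratedDeriv_id_mul_le (f : ShieldsSpace r) {ρ : ℝ} (hρ : ρ ∈ Ico (0 : ℝ) 1) :
    mean (iteratedDeriv (r + 1) fun z => z * f z) ρ ≤ (1 + 2 * ((r : ℝ) + 1)) * ‖f‖ := by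
  have hr := differentiableOn_iteratedDeriv f.differentiableOn r
  have h1 : MemH1 (deriv (iteratedDeriv r f)) := by
    rw [← iteratedDeriv_succ]; exact f.memH1
  have h2 := mean_le_of_deriv hr h1 hρ
  rw [← iteratedDeriv_succ] at h2
  have h3 := f.h1Norm_le_norm
  have h4 := f.iteratedDeriv_zero_le_norm (le_refl r)
  have h5 := (mean_le_h1Norm f.memH1 hρ).trans h3
  have hz : DifferentiableOn ℂ (fun z => z * iteratedDeriv (r + 1) f z) (ball 0 1) :=
    differentiableOn_id.fun_mul f.memH1.1
  have h6 : mean (fun z => z * iteratedDeriv (r + 1) f z) ρ ≤ mean (iteratedDeriv (r + 1) f) ρ := by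
    refine Real.circleAverage_mono (integrable_norm hz hρ) (integrable_norm f.memH1.1 hρ)
      fun z hz => ?_
    have : ‖z‖ ≤ 1 := by simpa using (ball_subset_closedBall (sphere_sub hρ hz))
    rw [norm_mul]
    exact mul_le_of_le_one_left (norm_nonneg _) this
  have e : EqOn (iteratedDeriv (r + 1) fun z => z * f z)
      ((fun z => z * iteratedDeriv (r + 1) f z) + ((r : ℂ) + 1) • iteratedDeriv r f)
      (ball 0 1) := iteratedDeriv_id_mul f.differentiableOn r
  rw [mean_congr e hρ]
  refine (mean_add_le hz (hr.const_smul _) hρ).trans ?_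
  rw [mean_smul]
  have h7 : ‖(r : ℂ) + 1‖ = (r : ℝ) + 1 := by
    have : ((r : ℂ) + 1) = ((r + 1 : ℕ) : ℂ) := by push_cast; rfl
    rw [this, Complex.norm_natCast]; push_cast; rfl
  rw [h7]
  have h8 : ((r : ℝ) + 1) * mean (iteratedDeriv r f) ρ ≤ ((r : ℝ) + 1) * (‖f‖ + ‖f‖) := by
    gcongr
    linarith
  linarith

theorem mulZ_mem (f : ShieldsSpace r) : (fun z => z * f z) ∈ submodule r :=
  ⟨differentiableOn_id.fun_mul f.differentiableOn,
    fun z hz => by simp [f.eq_zero_of_notMem hz],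
    differentiableOn_iteratedDeriv (differentiableOn_id.fun_mul f.differentiableOn) _,
    _, fun _ hρ => mean_iteratedDeriv_id_mul_le f hρ⟩

/-- Multiplication by `z` on `X_r` as a linear map. -/
def mulZLin (r : ℕ) : ShieldsSpace r →ₗ[ℂ] ShieldsSpace r where
  toFun f := (⟨fun z => z * f z, mulZ_mem f⟩ : submodule r)
  map_add' f g := Subtype.ext (funext fun z => mul_add z (f z) (g z))
  map_smul' c f := Subtype.ext (funext fun z => mul_left_comm z c (f z))

theorem norm_mulZLin_le (f : ShieldsSpace r) :
    ‖mulZLin r f‖ ≤ (((r : ℝ) + 1) * ((r : ℝ) + 1) + (1 + 2 * ((r : ℝ) + 1))) * ‖f‖ := by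
  have hf : (mulZLin r f).toFun = fun z => z * f z := rfl
  rw [norm_def, hf, add_mul]
  refine add_le_add ?_ (h1Norm_le fun ρ hρ => mean_iteratedDeriv_id_mul_le f hρ)
  have hj : ∀ j ∈ Finset.range (r + 1), ‖iteratedDeriv j (fun z => z * f z) 0‖ ≤
      ((r : ℝ) + 1) * ‖f‖ := by
    intro j hj
    have hj' : j ≤ r := Nat.lt_succ_iff.mp (Finset.mem_range.mp hj)
    cases j with
    | zero =>
      simp only [iteratedDeriv_zero, zero_mul, norm_zero]
      exact mul_nonneg (by positivity) (norm_nonneg f)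
    | succ k =>
      rw [iteratedDeriv_id_mul f.differentiableOn k (by simp)]
      simp only [zero_mul, zero_add, norm_mul]
      have h7 : ‖(k : ℂ) + 1‖ = (k : ℝ) + 1 := by
        have : ((k : ℂ) + 1) = ((k + 1 : ℕ) : ℂ) := by push_cast; rfl
        rw [this, Complex.norm_natCast]; push_cast; rfl
      rw [h7]
      have hk : (k : ℝ) ≤ r := by exact_mod_cast (Nat.le_of_succ_le hj')
      have := f.iteratedDeriv_zero_le_norm (j := k) (by omega)
      gcongr
  calc ∑ j ∈ Finset.range (r + 1), ‖iteratedDeriv j (fun z => z * f z) 0‖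
      ≤ ∑ _j ∈ Finset.range (r + 1), ((r : ℝ) + 1) * ‖f‖ := Finset.sum_le_sum hj
    _ = ((r : ℝ) + 1) * ((r : ℝ) + 1) * ‖f‖ := by
        simp [mul_assoc]

/-- The bounded operator `M_z` of multiplication by the independent variable on `X_r`. -/
noncomputable def Mz (r : ℕ) : ShieldsSpace r →L[ℂ] ShieldsSpace r :=
  (mulZLin r).mkContinuous _ norm_mulZLin_le

theorem Mz_apply (f : ShieldsSpace r) (z : ℂ) : Mz r f z = z * f z := rfl

end ShieldsSpace

/-!
Write `T = M_z` for multiplication by `z` on `X_r`. Every operator to be bounded from above is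
multiplication by an explicit function `φ`. Since `f^{(r+1)} ∈ H¹`, the derivatives of `f` of order
at most `r` are bounded on the disc (`norm_iteratedDeriv_le`), so by the Leibniz formula
multiplication by `φ` has norm at most a constant times `B` as soon as `|φ^{(k)}| ≤ B` for `k ≤ r`
and the integral means of `φ^{(r+1)}` are at most `B` (`IsMultiplier`, `IsMultiplier.norm_op_le`).

For the resolvent, `φ(z) = (μ - z)⁻¹`, and the means of `|μ - z|^{-r-2}` are estimated by pulling
out `(|μ| - 1)^{-r}` and averaging `|μ - z|⁻²` with the Poisson formula
(`circleAverage_inv_norm_sq`).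

For the means of order two, `φ` is a multiple of `P(λ z)` with `P(z) = ∑_{j ≤ n} ∑_{i ≤ j} z^i`.
Both `(1 - z) P` and `(1 - z)² P` are explicit, so `(1 - z)² P^{(r+1)}` is of order `n^{r+1}`, while
trivially `P^{(r+1)}` is of order `n^{r+3}`. Together these dominate `P^{(r+1)}` by
`n^{r+1} |1 - s z|⁻²` with `s = 1 - 1/(n + 2)`, whose means are of order `n^{r+2}` by the Poisson
formula again; dividing by `(n + 1)(n + 2)/2` leaves `n^r` (`isMultiplier_fejerSum`). Means of higher
order are convex combinations of those of order two (`norm_cesaroMean_succ_le`).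

The lower bounds come from the orbit of the constant function `1`. Hardy's inequality, read from the
leading coefficient downwards (`sum_div_le_pi_mul_h1Norm`), gives `‖T^n 1‖ ≥ c n^{r+1}`, and for
`M_n(T) 1 = (n + 1)⁻¹ ∑_{j ≤ n} z^j` it gives `c n^r` times a partial sum of the harmonic series.
Hardy's inequality and the boundedness of functions with derivative in `H¹` are both instances of
one integration by parts (`norm_two_pi_mul_sub_integral_le`).
-/

/-! ### Pointwise bounds from an integral bound on the derivative -/

namespace DiscHardy

open Metric Set Filter Topology

/-- A `C¹` function of period `2π` differs from its average by at most half the `L¹` norm of its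
derivative: integrate `(π - t) U'(t)` by parts. This serves both for the boundedness of functions
with derivative in `H¹` and, in the form of Hardy's inequality, for the unboundedness of the Cesàro
means of order one. -/
theorem norm_two_pi_mul_sub_integral_le {U U' : ℝ → ℂ} (hU : ∀ t, HasDerivAt U (U' t) t)
    (hU' : Continuous U') (hper : U (2 * Real.pi) = U 0) :
    ‖2 * Real.pi * U 0 - ∫ t in (0 : ℝ)..2 * Real.pi, U t‖ ≤
      Real.pi * ∫ t in (0 : ℝ)..2 * Real.pi, ‖U' t‖ := by
  have hv : ∀ t : ℝ, HasDerivAt (fun t : ℝ => (Real.pi : ℂ) - t) (-1) t := fun t => by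
    simpa using (Complex.ofRealCLM.hasDerivAt (x := t)).const_sub (Real.pi : ℂ)
  have h := intervalIntegral.integral_mul_deriv_eq_deriv_mul (a := 0) (b := 2 * Real.pi)
    (fun t _ => hv t) (fun t _ => hU t) intervalIntegrable_const
    (hU'.intervalIntegrable _ _)
  have e : (2 * Real.pi * U 0 - ∫ t in (0 : ℝ)..2 * Real.pi, U t) =
      -∫ t in (0 : ℝ)..2 * Real.pi, ((Real.pi : ℂ) - t) * U' t := by
    rw [h, hper]
    simp only [neg_one_mul, intervalIntegral.integral_neg]
    push_cast
    ring
  rw [e, norm_neg, ← intervalIntegral.integral_const_mul]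
  refine (intervalIntegral.norm_integral_le_integral_norm Real.two_pi_pos.le).trans ?_
  refine intervalIntegral.integral_mono_on Real.two_pi_pos.le ?_ ?_ fun t ht => ?_
  · exact Continuous.intervalIntegrable (by fun_prop) _ _
  · exact Continuous.intervalIntegrable (by fun_prop) _ _
  · rw [norm_mul, ← Complex.ofReal_sub, Complex.norm_real, Real.norm_eq_abs]
    gcongr
    rw [abs_le]
    constructor <;> linarith [ht.1, ht.2]

/-- A function with derivative in `H¹` is bounded on the disc. -/
theorem norm_le_of_deriv {h : ℂ → ℂ} (hh : DifferentiableOn ℂ h (ball 0 1))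
    (hd : MemH1 (deriv h)) {z : ℂ} (hz : z ∈ ball (0 : ℂ) 1) :
    ‖h z‖ ≤ ‖h 0‖ + Real.pi * h1Norm (deriv h) := by
  set ρ : ℝ := ‖z‖ with hρdef
  have hρ : ρ ∈ Ico (0 : ℝ) 1 := ⟨norm_nonneg _, by simpa using hz⟩
  have hmem : ∀ θ : ℝ, circleMap 0 ρ θ ∈ ball (0 : ℂ) 1 := fun θ =>
    sphere_sub hρ (circleMap_mem_sphere' 0 ρ θ)
  set α : ℝ := z.arg with hα
  have hzα : circleMap 0 ρ (0 + α) = z := by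
    simp [circleMap, hρdef, hα, Complex.norm_mul_exp_arg_mul_I]
  have hz2 : circleMap 0 ρ (2 * Real.pi + α) = z := by
    rw [add_comm, periodic_circleMap, ← hzα, zero_add]
  have hmap : ∀ t : ℝ, HasDerivAt (fun t : ℝ => circleMap 0 ρ (t + α))
      (circleMap 0 ρ (t + α) * Complex.I) t := fun t =>
    (hasDerivAt_circleMap 0 ρ (t + α)).comp_add_const t α
  have hU : ∀ t : ℝ, HasDerivAt (fun t : ℝ => h (circleMap 0 ρ (t + α)))
      (deriv h (circleMap 0 ρ (t + α)) * (circleMap 0 ρ (t + α) * Complex.I)) t := fun t =>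
    (hh.differentiableAt (isOpen_ball.mem_nhds (hmem (t + α)))).hasDerivAt.comp
      (h := fun t : ℝ => circleMap 0 ρ (t + α)) t (hmap t)
  have hcont : Continuous fun t : ℝ => deriv h (circleMap 0 ρ (t + α)) :=
    hd.1.continuousOn.comp_continuous (by fun_prop) fun t => hmem _
  have key := norm_two_pi_mul_sub_integral_le hU (by fun_prop) (by rw [hzα, hz2])
  rw [hzα] at key
  -- the average of `h` over the circle is `h 0`
  have hav : (∫ t in (0 : ℝ)..2 * Real.pi, h (circleMap 0 ρ (t + α))) = 2 * Real.pi * h 0 := by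
    have h1 : Real.circleAverage h 0 ρ = h 0 := by
      refine DiffContOnCl.circleAverage (DifferentiableOn.diffContOnCl (hh.mono ?_))
      rw [abs_of_nonneg hρ.1]
      exact closure_ball_subset_closedBall.trans (closedBall_subset_ball hρ.2)
    rw [Real.circleAverage_eq_integral_add α] at h1
    rw [← h1, Complex.real_smul]
    have := Real.two_pi_pos.ne'
    push_cast
    field_simp
  have hint : (∫ t in (0 : ℝ)..2 * Real.pi,
      ‖deriv h (circleMap 0 ρ (t + α)) * (circleMap 0 ρ (t + α) * Complex.I)‖) ≤
      2 * Real.pi * h1Norm (deriv h) := by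
    have h1 := mean_le_h1Norm hd hρ
    unfold mean at h1
    rw [Real.circleAverage_eq_integral_add α, smul_eq_mul, inv_mul_le_iff₀ Real.two_pi_pos] at h1
    refine le_trans ?_ h1
    refine intervalIntegral.integral_mono_on Real.two_pi_pos.le
      (Continuous.intervalIntegrable (by fun_prop) _ _)
      (Continuous.intervalIntegrable (by fun_prop) _ _) fun t _ => ?_
    rw [norm_mul, norm_mul, Complex.norm_I, mul_one, norm_circleMap_zero, abs_of_nonneg hρ.1]
    exact mul_le_of_le_one_right (norm_nonneg _) hρ.2.le
  rw [hav, ← mul_sub, norm_mul] at key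
  have h2 : ‖(2 * Real.pi : ℂ)‖ = 2 * Real.pi := by
    rw [← Complex.ofReal_ofNat, ← Complex.ofReal_mul, Complex.norm_real,
      Real.norm_of_nonneg Real.two_pi_pos.le]
  rw [h2] at key
  have h3 : 2 * Real.pi * ‖h z - h 0‖ ≤ 2 * Real.pi * (Real.pi * h1Norm (deriv h)) := by
    refine key.trans ((mul_le_mul_of_nonneg_left hint Real.pi_pos.le).trans_eq ?_)
    ring
  have h4 := le_of_mul_le_mul_left h3 Real.two_pi_pos
  have h5 := norm_le_insert' (h z) (h 0)
  linarith

end DiscHardy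

namespace ShieldsSpace

open Metric Set Filter Topology DiscHardy

variable {r : ℕ}

/-- All derivatives of order at most `r` of an element of `X_r` are bounded on the disc. -/
theorem norm_iteratedDeriv_le (f : ShieldsSpace r) {k : ℕ} (hk : k ≤ r) {z : ℂ}
    (hz : z ∈ ball (0 : ℂ) 1) :
    ‖iteratedDeriv (r - k) f z‖ ≤ (1 + Real.pi + k) * ‖f‖ := by
  induction k generalizing z with
  | zero =>
    have hd : MemH1 (deriv (iteratedDeriv r f)) := by
      rw [← iteratedDeriv_succ]; exact f.memH1
    have h := norm_le_of_deriv (differentiableOn_iteratedDeriv f.differentiableOn r) hd hz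
    rw [← iteratedDeriv_succ] at h
    have h1 := f.iteratedDeriv_zero_le_norm (le_refl r)
    have h2 := mul_le_mul_of_nonneg_left f.h1Norm_le_norm Real.pi_pos.le
    simp only [Nat.sub_zero, Nat.cast_zero]
    linarith
  | succ k ih =>
    have hidx : r - k = (r - (k + 1)) + 1 := by omega
    have hd := differentiableOn_iteratedDeriv f.differentiableOn (r - (k + 1))
    have := (convex_ball (0 : ℂ) 1).norm_image_sub_le_of_norm_deriv_le
      (f := iteratedDeriv (r - (k + 1)) f) (C := (1 + Real.pi + k) * ‖f‖) (x := 0) (y := z)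
      (fun x hx => hd.differentiableAt (isOpen_ball.mem_nhds hx))
      (fun x hx => by
        rw [← iteratedDeriv_succ, ← hidx]
        exact ih (by omega) hx)
      (by simp) hz
    rw [sub_zero] at this
    have h0 := f.iteratedDeriv_zero_le_norm (j := r - (k + 1)) (by omega)
    have h2 := norm_le_insert' (iteratedDeriv (r - (k + 1)) f z)
      (iteratedDeriv (r - (k + 1)) f 0)
    have hz1 : ‖z‖ ≤ 1 := by simpa using (ball_subset_closedBall hz)
    have h3 : (1 + Real.pi + k) * ‖f‖ * ‖z‖ ≤ (1 + Real.pi + k) * ‖f‖ * 1 := by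
      have := Real.pi_pos
      gcongr
    push_cast
    linarith

/-! ### Multipliers -/

/-- `φ` is holomorphic on the disc, its derivatives of order at most `r` are bounded by `B` there,
and the integral means of its derivative of order `r + 1` are at most `B`. Multiplication by such a
function is an operator on `X_r` of norm at most a constant times `B`. -/
structure IsMultiplier (r : ℕ) (B : ℝ) (φ : ℂ → ℂ) : Prop where
  differentiableOn : DifferentiableOn ℂ φ (ball 0 1)
  norm_le : ∀ k ≤ r, ∀ z ∈ ball (0 : ℂ) 1, ‖iteratedDeriv k φ z‖ ≤ B
  mean_le : ∀ ρ ∈ Ico (0 : ℝ) 1, mean (iteratedDeriv (r + 1) φ) ρ ≤ B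

theorem IsMultiplier.nonneg {B : ℝ} {φ : ℂ → ℂ} (hφ : IsMultiplier r B φ) : 0 ≤ B :=
  (norm_nonneg _).trans (hφ.norm_le 0 (Nat.zero_le r) 0 (by simp))

/-- The Leibniz formula on the disc. -/
theorem iteratedDeriv_mul_eqOn {φ f : ℂ → ℂ} (hφ : DifferentiableOn ℂ φ (ball 0 1))
    (hf : DifferentiableOn ℂ f (ball 0 1)) (n : ℕ) :
    EqOn (iteratedDeriv n fun z => φ z * f z) (fun z => ∑ i ∈ Finset.range (n + 1),
      (n.choose i : ℂ) * iteratedDeriv i φ z * iteratedDeriv (n - i) f z) (ball 0 1) :=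
  fun _ hz => iteratedDeriv_fun_mul (contDiffAt hφ hz n) (contDiffAt hf hz n)

theorem mean_le_of_norm_le {g : ℂ → ℂ} {h : ℂ → ℝ} (hg : DifferentiableOn ℂ g (ball 0 1)) {ρ : ℝ}
    (hρ : ρ ∈ Ico (0 : ℝ) 1) (hh : CircleIntegrable h 0 ρ)
    (hgh : ∀ z ∈ ball (0 : ℂ) 1, ‖g z‖ ≤ h z) : mean g ρ ≤ Real.circleAverage h 0 ρ :=
  Real.circleAverage_mono (integrable_norm hg hρ) hh fun z hz => hgh z (sphere_sub hρ hz)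

theorem IsMultiplier.mean_mul_le {B : ℝ} {φ : ℂ → ℂ} (hφ : IsMultiplier r B φ)
    (f : ShieldsSpace r) {ρ : ℝ} (hρ : ρ ∈ Ico (0 : ℝ) 1) :
    mean (iteratedDeriv (r + 1) fun z => φ z * f z) ρ ≤
      2 ^ (r + 1) * (B * ((1 + Real.pi + r) * ‖f‖)) := by
  have hB := hφ.nonneg
  have hπ := Real.pi_pos
  have hD : ∀ i, DifferentiableOn ℂ (iteratedDeriv i φ) (ball 0 1) :=
    differentiableOn_iteratedDeriv hφ.differentiableOn
  have hE : ∀ i, DifferentiableOn ℂ (iteratedDeriv i f) (ball 0 1) :=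
    differentiableOn_iteratedDeriv f.differentiableOn
  have hterm : ∀ i ∈ Finset.range (r + 2),
      mean (fun z => iteratedDeriv i φ z * iteratedDeriv (r + 1 - i) f z) ρ ≤
        B * ((1 + Real.pi + r) * ‖f‖) := by
    intro i hi
    have hi' : i ≤ r + 1 := Nat.lt_succ_iff.mp (Finset.mem_range.mp hi)
    rcases hi'.lt_or_eq with hlt | rfl
    · -- a bounded derivative of `φ` times a derivative of `f` of bounded mean
      have h1 : mean (iteratedDeriv (r + 1 - i) f) ρ ≤ (1 + Real.pi + r) * ‖f‖ := by
        rcases Nat.eq_zero_or_pos i with rfl | hpos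
        · refine ((mean_le_h1Norm f.memH1 hρ).trans f.h1Norm_le_norm).trans ?_
          exact le_mul_of_one_le_left (norm_nonneg _) (by linarith [Nat.cast_nonneg (α := ℝ) r])
        · refine (mean_le_of_norm_le (h := fun _ => (1 + Real.pi + r) * ‖f‖) (hE _) hρ
            (circleIntegrable_const _ _ _) fun z hz => ?_).trans_eq (Real.circleAverage_const _ _ _)
          have h2 := f.norm_iteratedDeriv_le (k := i - 1) (by omega) hz
          rw [show r - (i - 1) = r + 1 - i by omega] at h2
          refine h2.trans ?_
          have h3 : ((i - 1 : ℕ) : ℝ) ≤ r := by exact_mod_cast (by omega : i - 1 ≤ r)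
          gcongr
      refine le_trans (mean_le_of_norm_le (h := fun z => B • ‖iteratedDeriv (r + 1 - i) f z‖)
        ((hD _).fun_mul (hE _)) hρ
        ((integrable_norm (hE _) hρ).const_fun_smul) fun z hz => ?_) ?_
      · rw [norm_mul, smul_eq_mul]
        gcongr
        exact hφ.norm_le i (by omega) z hz
      · rw [Real.circleAverage_fun_smul, smul_eq_mul]
        exact mul_le_mul_of_nonneg_left h1 hB
    · -- the derivative of order `r + 1` of `φ` times the bounded function `f`
      refine le_trans (mean_le_of_norm_le
        (h := fun z => ((1 + Real.pi + r) * ‖f‖) • ‖iteratedDeriv (r + 1) φ z‖)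
        ((hD _).fun_mul (hE _)) hρ
        ((integrable_norm (hD _) hρ).const_fun_smul) fun z hz => ?_) ?_
      · rw [norm_mul, smul_eq_mul, mul_comm]
        gcongr
        have h2 := f.norm_iteratedDeriv_le (k := r) le_rfl hz
        rwa [Nat.sub_self] at h2 ⊢
      · rw [Real.circleAverage_fun_smul, smul_eq_mul, mul_comm]
        exact mul_le_mul_of_nonneg_right (hφ.mean_le ρ hρ) (by positivity)
  rw [mean_congr (iteratedDeriv_mul_eqOn hφ.differentiableOn f.differentiableOn (r + 1)) hρ]
  have hci : ∀ i ∈ Finset.range (r + 2), CircleIntegrable (fun z => ((r + 1).choose i : ℝ) •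
      ‖iteratedDeriv i φ z * iteratedDeriv (r + 1 - i) f z‖) 0 ρ := fun i _ =>
    (integrable_norm ((hD _).fun_mul (hE _)) hρ).const_fun_smul
  calc mean (fun z => ∑ i ∈ Finset.range (r + 1 + 1), ((r + 1).choose i : ℂ) *
        iteratedDeriv i φ z * iteratedDeriv (r + 1 - i) f z) ρ
      ≤ Real.circleAverage (fun z => ∑ i ∈ Finset.range (r + 2), ((r + 1).choose i : ℝ) •
          ‖iteratedDeriv i φ z * iteratedDeriv (r + 1 - i) f z‖) 0 ρ := by
        refine mean_le_of_norm_le ?_ hρ (CircleIntegrable.fun_sum _ hci) fun z _ => ?_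
        · exact DifferentiableOn.fun_sum fun i _ => ((hD i).const_mul _).fun_mul (hE _)
        · refine (norm_sum_le _ _).trans_eq (Finset.sum_congr rfl fun i _ => ?_)
          rw [mul_assoc, norm_mul, Complex.norm_natCast, smul_eq_mul]
    _ = ∑ i ∈ Finset.range (r + 2), ((r + 1).choose i : ℝ) *
          mean (fun z => iteratedDeriv i φ z * iteratedDeriv (r + 1 - i) f z) ρ := by
        rw [Real.circleAverage_fun_sum hci]
        refine Finset.sum_congr rfl fun i _ => ?_
        rw [Real.circleAverage_fun_smul, smul_eq_mul]; rfl
    _ ≤ ∑ i ∈ Finset.range (r + 2), ((r + 1).choose i : ℝ) * (B * ((1 + Real.pi + r) * ‖f‖)) :=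
        Finset.sum_le_sum fun i hi => mul_le_mul_of_nonneg_left (hterm i hi) (Nat.cast_nonneg _)
    _ = 2 ^ (r + 1) * (B * ((1 + Real.pi + r) * ‖f‖)) := by
        rw [← Finset.sum_mul, ← Nat.cast_sum, Nat.sum_range_choose]
        push_cast; rfl

theorem IsMultiplier.norm_iteratedDeriv_mul_le {B : ℝ} {φ : ℂ → ℂ} (hφ : IsMultiplier r B φ)
    (f : ShieldsSpace r) {j : ℕ} (hj : j ≤ r) :
    ‖iteratedDeriv j (fun z => φ z * f z) 0‖ ≤
      2 ^ (r + 1) * (B * ((1 + Real.pi + r) * ‖f‖)) := by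
  have hB := hφ.nonneg
  have hπ := Real.pi_pos
  have h0 : (0 : ℂ) ∈ ball (0 : ℂ) 1 := by simp
  rw [iteratedDeriv_mul_eqOn hφ.differentiableOn f.differentiableOn j h0]
  calc ‖∑ i ∈ Finset.range (j + 1), (j.choose i : ℂ) * iteratedDeriv i φ 0 *
        iteratedDeriv (j - i) f 0‖
      ≤ ∑ i ∈ Finset.range (j + 1), (j.choose i : ℝ) * (B * ((1 + Real.pi + r) * ‖f‖)) := by
        refine norm_sum_le_of_le _ fun i hi => ?_
        have hi' : i ≤ j := Nat.lt_succ_iff.mp (Finset.mem_range.mp hi)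
        rw [mul_assoc, norm_mul, norm_mul, Complex.norm_natCast]
        gcongr
        · exact hφ.norm_le i (by omega) 0 h0
        · refine (f.iteratedDeriv_zero_le_norm (by omega)).trans ?_
          exact le_mul_of_one_le_left (norm_nonneg _) (by linarith [Nat.cast_nonneg (α := ℝ) r])
    _ = 2 ^ j * (B * ((1 + Real.pi + r) * ‖f‖)) := by
        rw [← Finset.sum_mul, ← Nat.cast_sum, Nat.sum_range_choose]
        push_cast; rfl
    _ ≤ 2 ^ (r + 1) * (B * ((1 + Real.pi + r) * ‖f‖)) := by
        gcongr
        · norm_num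
        · omega

theorem IsMultiplier.mul_mem {B : ℝ} {φ : ℂ → ℂ} (hφ : IsMultiplier r B φ) (f : ShieldsSpace r) :
    (fun z => φ z * f z) ∈ submodule r :=
  ⟨hφ.differentiableOn.fun_mul f.differentiableOn,
    fun z hz => by simp [f.eq_zero_of_notMem hz],
    differentiableOn_iteratedDeriv (hφ.differentiableOn.fun_mul f.differentiableOn) _,
    _, fun _ hρ => hφ.mean_mul_le f hρ⟩

/-- The constant in the norm estimate for multiplication operators on `X_r`. -/
noncomputable def multiplierConst (r : ℕ) : ℝ :=
  ((r : ℝ) + 2) * (2 ^ (r + 1) * (1 + Real.pi + r))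

theorem multiplierConst_nonneg (r : ℕ) : 0 ≤ multiplierConst r := by
  have := Real.pi_pos
  unfold multiplierConst
  positivity

/-- The product of a multiplier and an element of `X_r`, as an element of `X_r`. -/
def IsMultiplier.mul {B : ℝ} {φ : ℂ → ℂ} (hφ : IsMultiplier r B φ) (f : ShieldsSpace r) :
    ShieldsSpace r :=
  (⟨fun z => φ z * f z, hφ.mul_mem f⟩ : submodule r)

theorem IsMultiplier.norm_mul_le {B : ℝ} {φ : ℂ → ℂ} (hφ : IsMultiplier r B φ)
    (f : ShieldsSpace r) : ‖hφ.mul f‖ ≤ multiplierConst r * B * ‖f‖ := by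
  have hf : (hφ.mul f).toFun = fun z => φ z * f z := rfl
  rw [norm_def, hf]
  have h1 : ∑ j ∈ Finset.range (r + 1), ‖iteratedDeriv j (fun z => φ z * f z) 0‖ ≤
      ((r : ℝ) + 1) * (2 ^ (r + 1) * (B * ((1 + Real.pi + r) * ‖f‖))) := by
    refine (Finset.sum_le_card_nsmul _ _ _ fun j hj =>
      hφ.norm_iteratedDeriv_mul_le f (Nat.lt_succ_iff.mp (Finset.mem_range.mp hj))).trans_eq ?_
    simp
  have h2 := h1Norm_le fun ρ hρ => hφ.mean_mul_le f (ρ := ρ) hρ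
  refine (add_le_add h1 h2).trans_eq ?_
  unfold multiplierConst
  ring

/-- Multiplication by a multiplier as a bounded operator on `X_r`. -/
noncomputable def IsMultiplier.op {B : ℝ} {φ : ℂ → ℂ} (hφ : IsMultiplier r B φ) :
    ShieldsSpace r →L[ℂ] ShieldsSpace r :=
  LinearMap.mkContinuous
    { toFun := hφ.mul
      map_add' := fun f g => Subtype.ext (funext fun z => mul_add (φ z) (f z) (g z))
      map_smul' := fun c f => Subtype.ext (funext fun z => mul_left_comm (φ z) c (f z)) }
    (multiplierConst r * B) hφ.norm_mul_le

theorem IsMultiplier.op_apply {B : ℝ} {φ : ℂ → ℂ} (hφ : IsMultiplier r B φ) (f : ShieldsSpace r)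
    (z : ℂ) : hφ.op f z = φ z * f z := rfl

theorem IsMultiplier.norm_op_le {B : ℝ} {φ : ℂ → ℂ} (hφ : IsMultiplier r B φ) :
    ‖hφ.op‖ ≤ multiplierConst r * B :=
  LinearMap.mkContinuous_norm_le _ (mul_nonneg (multiplierConst_nonneg r) hφ.nonneg) _

/-- An operator which acts as multiplication by a multiplier satisfies its norm estimate. -/
theorem IsMultiplier.norm_le_of_apply {B : ℝ} {φ : ℂ → ℂ} (hφ : IsMultiplier r B φ)
    {S : ShieldsSpace r →L[ℂ] ShieldsSpace r}
    (hS : ∀ (f : ShieldsSpace r), ∀ z ∈ ball (0 : ℂ) 1, S f z = φ z * f z) :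
    ‖S‖ ≤ multiplierConst r * B := by
  have : S = hφ.op := by
    ext f
    exact ext_ball fun z hz => hS f z hz
  exact this ▸ hφ.norm_op_le

end ShieldsSpace

namespace DiscHardy

open Metric Set Filter Topology

/-! ### Integral means of `|1 - w z|⁻²` -/

theorem one_sub_mul_ne_zero {w z : ℂ} (hw : ‖w‖ ≤ 1) (hz : z ∈ ball (0 : ℂ) 1) : 1 - w * z ≠ 0 := by
  intro h
  have h1 : ‖w * z‖ = 1 := by rw [← sub_eq_zero.mp h, norm_one]
  rw [norm_mul] at h1
  have h2 : ‖z‖ < 1 := by simpa using hz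
  have := mul_le_mul_of_nonneg_right hw (norm_nonneg z)
  linarith

theorem circleIntegrable_inv_norm_sq {w : ℂ} (hw : ‖w‖ ≤ 1) {ρ : ℝ} (hρ : ρ ∈ Ico (0 : ℝ) 1) :
    CircleIntegrable (fun z => (‖1 - w * z‖ ^ 2)⁻¹) 0 ρ := by
  refine ContinuousOn.circleIntegrable' (ContinuousOn.inv₀ (by fun_prop) fun z hz => ?_)
  have := one_sub_mul_ne_zero hw (sphere_sub hρ hz)
  positivity

/-- The average of `|1 - w z|⁻²` over a circle about the origin is given by the Poisson formula. -/
theorem circleAverage_inv_norm_sq {w : ℂ} (hw : ‖w‖ ≤ 1) {ρ : ℝ} (hρ : ρ ∈ Ico (0 : ℝ) 1) :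
    Real.circleAverage (fun z => (‖1 - w * z‖ ^ 2)⁻¹) 0 ρ = (1 - ‖w‖ ^ 2 * ρ ^ 2)⁻¹ := by
  have hρabs : |ρ| = ρ := abs_of_nonneg hρ.1
  rcases hρ.1.eq_or_lt with h0 | hpos
  · simp [← h0]
  have hd : DiffContOnCl ℂ (fun z => (1 - w * z)⁻¹) (ball 0 |ρ|) := by
    refine DifferentiableOn.diffContOnCl (DifferentiableOn.inv (by fun_prop) fun z hz => ?_)
    refine one_sub_mul_ne_zero hw (?_ : z ∈ ball (0 : ℂ) 1)
    rw [hρabs] at hz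
    exact closure_ball_subset_closedBall.trans (closedBall_subset_ball hρ.2) hz
  -- on the circle `|z| = ρ`, the conjugate of `1 - w z` is `(z - a) / z` with `a = ρ² conj w`
  set a : ℂ := (starRingEnd ℂ) w * (ρ : ℂ) ^ 2 with ha
  have hanorm : ‖a‖ < ρ := by
    rw [ha, norm_mul, RCLike.norm_conj, norm_pow, Complex.norm_real, Real.norm_of_nonneg hρ.1]
    have := mul_le_mul_of_nonneg_right hw (sq_nonneg ρ)
    nlinarith [hρ.2]
  have key := hd.circleAverage_smul_div (w := a) (by rw [hρabs]; simpa using hanorm)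
  have e : Real.circleAverage (fun z => ((z - 0) / (z - a)) • (1 - w * z)⁻¹) 0 ρ =
      Real.circleAverage (fun z => (((‖1 - w * z‖ ^ 2)⁻¹ : ℝ) : ℂ)) 0 ρ := by
    refine Real.circleAverage_congr_sphere fun z hz => ?_
    have hz' : ‖z‖ = ρ := by rw [hρabs] at hz; simpa using hz
    have hz0 : z ≠ 0 := by rw [← norm_pos_iff, hz']; exact hpos
    have hza : z - a ≠ 0 := fun h => by
      rw [sub_eq_zero.mp h] at hz'; linarith
    have hzz : z * (starRingEnd ℂ) z = (ρ : ℂ) ^ 2 := by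
      rw [Complex.mul_conj, Complex.normSq_eq_norm_sq, hz']; push_cast; rfl
    have h1 : (starRingEnd ℂ) (1 - w * z) = (z - a) / z := by
      rw [eq_div_iff hz0, ha, ← hzz]; simp; ring
    have h2 : ((‖1 - w * z‖ : ℂ)) ^ 2 = (1 - w * z) * ((z - a) / z) := by
      rw [← h1, Complex.mul_conj, Complex.normSq_eq_norm_sq]; push_cast; rfl
    simp only [sub_zero, smul_eq_mul]
    push_cast
    rw [h2, mul_inv, inv_div, mul_comm]
  rw [e] at key
  have h3 := Complex.ofRealCLM.circleAverage_comp_comm (circleIntegrable_inv_norm_sq hw hρ)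
  simp only [Function.comp_def, Complex.ofRealCLM_apply] at h3
  have h3' := h3.symm.trans key
  have h4 : (1 - w * a)⁻¹ = (((1 - ‖w‖ ^ 2 * ρ ^ 2)⁻¹ : ℝ) : ℂ) := by
    have : w * (starRingEnd ℂ) w = (‖w‖ : ℂ) ^ 2 := by
      rw [Complex.mul_conj, Complex.normSq_eq_norm_sq]; push_cast; rfl
    push_cast
    rw [ha, ← mul_assoc, this]
  rw [h4] at h3'
  exact_mod_cast h3'

theorem circleAverage_inv_norm_sq_le {w : ℂ} (hw : ‖w‖ < 1) {ρ : ℝ} (hρ : ρ ∈ Ico (0 : ℝ) 1) :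
    Real.circleAverage (fun z => (‖1 - w * z‖ ^ 2)⁻¹) 0 ρ ≤ (1 - ‖w‖)⁻¹ := by
  rw [circleAverage_inv_norm_sq hw.le hρ]
  have h0 := norm_nonneg w
  have h1 : ρ ^ 2 ≤ 1 := pow_le_one₀ hρ.1 hρ.2.le
  apply inv_anti₀ (by linarith)
  nlinarith [mul_le_mul_of_nonneg_left h1 (sq_nonneg ‖w‖)]

end DiscHardy

namespace ShieldsSpace

open Metric Set Filter Topology DiscHardy

variable {r : ℕ}

/-! ### The resolvent -/

theorem iteratedDeriv_inv_sub (μ : ℂ) (k : ℕ) (z : ℂ) :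
    iteratedDeriv k (fun z => (μ - z)⁻¹) z = (k.factorial : ℂ) * ((μ - z) ^ (k + 1))⁻¹ := by
  have h := congrFun (iter_deriv_inv_linear k (-1) μ) z
  simp only [neg_one_mul, neg_add_eq_sub] at h
  rw [iteratedDeriv_eq_iterate, h, show (-1 - (k : ℤ)) = -((k + 1 : ℕ) : ℤ) by push_cast; ring,
    zpow_neg, zpow_natCast, mul_right_comm _ _ ((-1 : ℂ) ^ k), ← mul_pow]
  simp

theorem isMultiplier_inv_sub (r : ℕ) {μ : ℂ} (hμ : 1 < ‖μ‖) :
    IsMultiplier r ((r + 1).factorial * (‖μ‖ ^ r / (‖μ‖ - 1) ^ (r + 1))) fun z => (μ - z)⁻¹ := by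
  have hpos : 0 < ‖μ‖ - 1 := by linarith
  have hlow : ∀ z ∈ ball (0 : ℂ) 1, ‖μ‖ - 1 ≤ ‖μ - z‖ := fun z hz => by
    have h1 : ‖z‖ ≤ 1 := by simpa using ball_subset_closedBall hz
    have := norm_sub_norm_le μ z
    linarith
  have hne : ∀ z ∈ ball (0 : ℂ) 1, μ - z ≠ 0 := fun z hz h => by
    have := hlow z hz
    rw [h, norm_zero] at this
    linarith
  have hd : DifferentiableOn ℂ (fun z => (μ - z)⁻¹) (ball 0 1) :=
    DifferentiableOn.inv (by fun_prop) hne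
  refine ⟨hd, fun k hk z hz => ?_, fun ρ hρ => ?_⟩
  · rw [iteratedDeriv_inv_sub, norm_mul, Complex.norm_natCast, norm_inv, norm_pow]
    have h1 : (‖μ - z‖ ^ (k + 1))⁻¹ ≤ ((‖μ‖ - 1) ^ (k + 1))⁻¹ :=
      inv_anti₀ (by positivity) (pow_le_pow_left₀ hpos.le (hlow z hz) _)
    have h2 : ((‖μ‖ - 1) ^ (k + 1))⁻¹ ≤ ‖μ‖ ^ r / (‖μ‖ - 1) ^ (r + 1) := by
      rw [le_div_iff₀ (by positivity), inv_mul_le_iff₀ (by positivity),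
        show r + 1 = (k + 1) + (r - k) by omega, pow_add]
      have h3 : (‖μ‖ - 1) ^ (r - k) ≤ ‖μ‖ ^ r :=
        (pow_le_pow_left₀ hpos.le (by linarith) _).trans
          (pow_le_pow_right₀ hμ.le (Nat.sub_le r k))
      gcongr
    have h4 : (k.factorial : ℝ) ≤ (r + 1).factorial := by
      exact_mod_cast Nat.factorial_le (by omega)
    have h5 := h1.trans h2
    gcongr
  · -- all but two of the `r + 2` factors `|μ - z|⁻¹` are at most `(|μ| - 1)⁻¹`, and the remaining
    -- two are averaged exactly, with `|μ - z| = |μ| |1 - μ⁻¹ z|`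
    have hμ0 : μ ≠ 0 := norm_pos_iff.mp (by linarith)
    have hw : ‖μ⁻¹‖ < 1 := by rw [norm_inv]; exact inv_lt_one_of_one_lt₀ hμ
    have hci := circleIntegrable_inv_norm_sq hw.le hρ
    have h1 : (1 - ‖μ⁻¹‖)⁻¹ = ‖μ‖ / (‖μ‖ - 1) := by
      rw [norm_inv]
      field_simp
    refine (mean_le_of_norm_le (h := fun z => ((r + 1).factorial * (((‖μ‖ - 1) ^ r)⁻¹ *
      (‖μ‖ ^ 2)⁻¹)) • (‖1 - μ⁻¹ * z‖ ^ 2)⁻¹) (differentiableOn_iteratedDeriv hd _) hρ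
      hci.const_fun_smul fun z hz => ?_).trans ?_
    · rw [iteratedDeriv_inv_sub, norm_mul, Complex.norm_natCast, norm_inv, norm_pow, smul_eq_mul,
        mul_assoc]
      refine mul_le_mul_of_nonneg_left ?_ (Nat.cast_nonneg _)
      have h2 : ‖μ - z‖ = ‖μ‖ * ‖1 - μ⁻¹ * z‖ := by
        rw [← norm_mul, mul_sub, mul_one, mul_inv_cancel_left₀ hμ0]
      rw [mul_assoc, ← mul_inv (‖μ‖ ^ 2), ← mul_pow, ← h2, ← mul_inv,
        show r + 1 + 1 = r + 2 by ring, pow_add]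
      have h3 := hlow z hz
      have h4 : 0 < ‖μ - z‖ := hpos.trans_le h3
      gcongr
    · rw [Real.circleAverage_fun_smul, smul_eq_mul, mul_assoc]
      refine mul_le_mul_of_nonneg_left ?_ (Nat.cast_nonneg _)
      have h2 := circleAverage_inv_norm_sq_le hw hρ
      rw [h1] at h2
      calc ((‖μ‖ - 1) ^ r)⁻¹ * (‖μ‖ ^ 2)⁻¹ *
            Real.circleAverage (fun z => (‖1 - μ⁻¹ * z‖ ^ 2)⁻¹) 0 ρ
          ≤ ((‖μ‖ - 1) ^ r)⁻¹ * (‖μ‖ ^ 2)⁻¹ * (‖μ‖ / (‖μ‖ - 1)) := by gcongr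
        _ = ‖μ‖⁻¹ / (‖μ‖ - 1) ^ (r + 1) := by
          have : 0 < ‖μ‖ := by linarith
          field_simp
          rw [pow_succ']
        _ ≤ ‖μ‖ ^ r / (‖μ‖ - 1) ^ (r + 1) := by
          gcongr
          exact (inv_le_one_of_one_le₀ hμ.le).trans (one_le_pow₀ hμ.le)

/-- The resolvent of `M_z` outside the closed unit disc is multiplication by `(μ - z)⁻¹`. -/
theorem mem_resolventSet_and_norm_resolvent_le (r : ℕ) {μ : ℂ} (hμ : 1 < ‖μ‖) :
    μ ∈ resolventSet ℂ (Mz r) ∧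
      (‖μ‖ - 1) ^ (r + 1) / ‖μ‖ ^ r * ‖resolvent (Mz r) μ‖ ≤
        multiplierConst r * (r + 1).factorial := by
  have hφ := isMultiplier_inv_sub r hμ
  have hne : ∀ z ∈ ball (0 : ℂ) 1, μ - z ≠ 0 := fun z hz h => by
    have h1 : ‖z‖ < 1 := by simpa using hz
    rw [← sub_eq_zero.mp h] at h1
    linarith
  have happ : ∀ (f : ShieldsSpace r) (z : ℂ),
      (algebraMap ℂ (ShieldsSpace r →L[ℂ] ShieldsSpace r) μ - Mz r) f z = (μ - z) * f z := by
    intro f z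
    rw [sub_mul]
    rfl
  have h1 : (algebraMap ℂ (ShieldsSpace r →L[ℂ] ShieldsSpace r) μ - Mz r) * hφ.op = 1 := by
    ext f
    refine ext_ball fun z hz => ?_
    rw [mul_apply_eq_comp, happ, hφ.op_apply, mul_inv_cancel_left₀ (hne z hz)]
    rfl
  have h2 : hφ.op * (algebraMap ℂ (ShieldsSpace r →L[ℂ] ShieldsSpace r) μ - Mz r) = 1 := by
    ext f
    refine ext_ball fun z hz => ?_
    rw [mul_apply_eq_comp, hφ.op_apply, happ, inv_mul_cancel_left₀ (hne z hz)]
    rfl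
  let u : (ShieldsSpace r →L[ℂ] ShieldsSpace r)ˣ :=
    ⟨algebraMap ℂ (ShieldsSpace r →L[ℂ] ShieldsSpace r) μ - Mz r, hφ.op, h1, h2⟩
  have hres : resolvent (Mz r) μ = hφ.op := Ring.inverse_unit u
  refine ⟨u.isUnit, ?_⟩
  rw [hres]
  have hpos : 0 < ‖μ‖ - 1 := by linarith
  have hpos' : 0 < ‖μ‖ := by linarith
  refine (mul_le_mul_of_nonneg_left hφ.norm_op_le (by positivity)).trans_eq ?_
  field_simp

end ShieldsSpace

/-! ### Cesàro means of order at least two -/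

theorem cesaroMean_two {X : Type*} [NormedAddCommGroup X] [NormedSpace ℂ X]
    (S : X →L[ℂ] X) (n : ℕ) :
    cesaroMean S 2 n = (2 / (((n : ℂ) + 1) * ((n : ℂ) + 2))) •
      ∑ j ∈ Finset.range (n + 1), ∑ i ∈ Finset.range (j + 1), S ^ i := by
  have h : ∀ j : ℕ, ((j + 1).factorial : ℂ) / (j.factorial : ℂ) * ((j : ℂ) + 1)⁻¹ = 1 := fun j => by
    have h1 : (j.factorial : ℂ) ≠ 0 := Nat.cast_ne_zero.mpr j.factorial_ne_zero
    have h2 : (j : ℂ) + 1 ≠ 0 := Nat.cast_add_one_ne_zero j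
    rw [Nat.factorial_succ]
    push_cast
    field_simp
  rw [cesaroMean]
  congr 1
  · rw [Finset.prod_range_succ, Finset.prod_range_one]
    push_cast
    congr 1 <;> ring
  · refine Finset.sum_congr rfl fun j _ => ?_
    rw [cesaroMean_one, smul_smul, h, one_smul]

/-- The weights in the recursion for the Cesàro means add up to one. -/
theorem succ_mul_sum_factorial_div (p n : ℕ) :
    ((p : ℝ) + 1) * ∑ j ∈ Finset.range (n + 1), ((j + p).factorial : ℝ) / j.factorial =
      ∏ k ∈ Finset.range (p + 1), ((n : ℝ) + k + 1) := by
  have hprod : ∀ m q : ℕ, ∏ k ∈ Finset.range q, ((m : ℝ) + k + 1) =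
      ((m + q).factorial : ℝ) / m.factorial := by
    intro m q
    rw [eq_div_iff (Nat.cast_ne_zero.mpr m.factorial_ne_zero)]
    induction q with
    | zero => simp
    | succ q ih =>
      rw [Finset.prod_range_succ, mul_right_comm, ih, ← add_assoc, Nat.factorial_succ]
      push_cast
      ring
  rw [hprod]
  induction n with
  | zero =>
    rw [Finset.sum_range_one, zero_add, zero_add, Nat.factorial_succ]
    push_cast
    ring
  | succ n ih =>
    have h1 : (n.factorial : ℝ) ≠ 0 := Nat.cast_ne_zero.mpr n.factorial_ne_zero
    have h2 : (n : ℝ) + 1 ≠ 0 := Nat.cast_add_one_ne_zero n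
    rw [Finset.sum_range_succ, mul_add, ih, show n + 1 + (p + 1) = (n + p + 1) + 1 by ring,
      show n + 1 + p = n + p + 1 by ring, show n + (p + 1) = n + p + 1 by ring,
      Nat.factorial_succ (n + p + 1), Nat.factorial_succ n]
    push_cast
    field_simp
    ring

/-- A Cesàro mean is a convex combination of the means of the next lower order. -/
theorem norm_cesaroMean_succ_le {X : Type*} [NormedAddCommGroup X] [NormedSpace ℂ X]
    (S : X →L[ℂ] X) {p n : ℕ} {D : ℝ} (h : ∀ j ≤ n, ‖cesaroMean S p j‖ ≤ D) :
    ‖cesaroMean S (p + 1) n‖ ≤ D := by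
  have hsum := succ_mul_sum_factorial_div p n
  set W : ℝ := ∏ k ∈ Finset.range (p + 1), ((n : ℝ) + k + 1) with hW
  have hWpos : 0 < W := Finset.prod_pos fun k _ => by positivity
  have hWc : (∏ k ∈ Finset.range (p + 1), ((n : ℂ) + (k : ℂ) + 1)) = (W : ℂ) := by
    rw [hW]; push_cast; rfl
  have hc : ‖((p : ℂ) + 1) / (W : ℂ)‖ = ((p : ℝ) + 1) / W := by
    rw [norm_div, Complex.norm_real, Real.norm_of_nonneg hWpos.le, ← Nat.cast_add_one,
      Complex.norm_natCast, Nat.cast_add_one]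
  rw [cesaroMean, hWc, norm_smul, hc]
  calc ((p : ℝ) + 1) / W * ‖∑ j ∈ Finset.range (n + 1),
        ((Nat.factorial (j + p) : ℂ) / (Nat.factorial j : ℂ)) • cesaroMean S p j‖
      ≤ ((p : ℝ) + 1) / W * ∑ j ∈ Finset.range (n + 1),
          ((j + p).factorial : ℝ) / j.factorial * D := by
        gcongr
        refine norm_sum_le_of_le _ fun j hj => ?_
        rw [norm_smul, norm_div, Complex.norm_natCast, Complex.norm_natCast]
        gcongr
        exact h j (Nat.lt_succ_iff.mp (Finset.mem_range.mp hj))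
    _ = D := by
        rw [← Finset.sum_mul, div_mul_eq_mul_div, ← mul_assoc, hsum]
        field_simp

namespace ShieldsSpace

open Metric Set Filter Topology DiscHardy

variable {r : ℕ}

/-- The polynomial `∑_{j ≤ n} ∑_{i ≤ j} z^i`, a multiple of the analytic part of the Fejér
kernel. -/
def fejerSum (n : ℕ) (z : ℂ) : ℂ :=
  ∑ j ∈ Finset.range (n + 1), ∑ i ∈ Finset.range (j + 1), z ^ i

theorem norm_iteratedDeriv_pow_le {i N : ℕ} (hi : i ≤ N) (k : ℕ) {z : ℂ}
    (hz : z ∈ ball (0 : ℂ) 1) : ‖iteratedDeriv k (fun z : ℂ => z ^ i) z‖ ≤ (N : ℝ) ^ k := by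
  have hz1 : ‖z‖ ≤ 1 := by simpa using ball_subset_closedBall hz
  rw [iteratedDeriv_pow, norm_mul, Complex.norm_natCast, norm_pow]
  refine (mul_le_of_le_one_right (Nat.cast_nonneg _) (pow_le_one₀ (norm_nonneg _) hz1)).trans ?_
  exact_mod_cast (Nat.descFactorial_le_pow i k).trans (Nat.pow_le_pow_left hi k)

theorem norm_iteratedDeriv_fejerSum_le (n k : ℕ) {z : ℂ} (hz : z ∈ ball (0 : ℂ) 1) :
    ‖iteratedDeriv k (fejerSum n) z‖ ≤ ((n : ℝ) + 2) ^ (k + 2) := by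
  unfold fejerSum
  rw [iteratedDeriv_fun_sum fun j _ => by fun_prop]
  have h : ∀ j ∈ Finset.range (n + 1),
      ‖iteratedDeriv k (fun z : ℂ => ∑ i ∈ Finset.range (j + 1), z ^ i) z‖ ≤
        ((n : ℝ) + 2) ^ (k + 1) := by
    intro j hj
    have hj' := Finset.mem_range.mp hj
    rw [iteratedDeriv_fun_sum fun j _ => by fun_prop]
    refine (norm_sum_le_of_le _ fun i hi => norm_iteratedDeriv_pow_le (N := n + 2) ?_ k
      hz).trans ?_
    · have := Finset.mem_range.mp hi
      omega
    · rw [Finset.sum_const, Finset.card_range, nsmul_eq_mul, pow_succ']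
      push_cast
      have : (j : ℝ) + 1 ≤ n + 2 := by exact_mod_cast (by omega : j + 1 ≤ n + 2)
      gcongr
  refine (norm_sum_le_of_le _ h).trans ?_
  rw [Finset.sum_const, Finset.card_range, nsmul_eq_mul, pow_succ' _ (k + 1)]
  push_cast
  gcongr
  norm_num

/-- The constant term is written `z ^ 0` so that the bound for the derivatives of powers covers it. -/
theorem one_sub_mul_fejerSum (n : ℕ) (z : ℂ) :
    (1 - z) * fejerSum n z = ∑ j ∈ Finset.range (n + 1), (z ^ 0 - z ^ (j + 1)) := by
  rw [fejerSum, Finset.mul_sum]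
  exact Finset.sum_congr rfl fun j _ => by rw [mul_neg_geom_sum, pow_zero]

theorem norm_iteratedDeriv_one_sub_mul_fejerSum_le (n k : ℕ) {z : ℂ} (hz : z ∈ ball (0 : ℂ) 1) :
    ‖iteratedDeriv k (fun z => (1 - z) * fejerSum n z) z‖ ≤ 2 * ((n : ℝ) + 2) ^ (k + 1) := by
  simp only [one_sub_mul_fejerSum]
  rw [iteratedDeriv_fun_sum fun j _ => by fun_prop]
  have h : ∀ j ∈ Finset.range (n + 1), ‖iteratedDeriv k (fun z : ℂ => z ^ 0 - z ^ (j + 1)) z‖ ≤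
      2 * ((n : ℝ) + 2) ^ k := by
    intro j hj
    have hj' := Finset.mem_range.mp hj
    rw [iteratedDeriv_fun_sub (by fun_prop) (by fun_prop)]
    have h1 := norm_iteratedDeriv_pow_le (i := 0) (N := n + 2) (by omega) k hz
    have h2 := norm_iteratedDeriv_pow_le (i := j + 1) (N := n + 2) (by omega) k hz
    push_cast at h1 h2
    exact (norm_sub_le _ _).trans (by linarith)
  refine (norm_sum_le_of_le _ h).trans ?_
  rw [Finset.sum_const, Finset.card_range, nsmul_eq_mul, pow_succ]
  have h3 : (0 : ℝ) ≤ ((n : ℝ) + 2) ^ k := by positivity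
  push_cast
  nlinarith

theorem one_sub_sq_mul_fejerSum (n : ℕ) (z : ℂ) :
    (1 - z) * ((1 - z) * fejerSum n z) =
      ((n : ℂ) + 1) * z ^ 0 - ((n : ℂ) + 2) * z ^ 1 + z ^ (n + 2) := by
  rw [one_sub_mul_fejerSum]
  induction n with
  | zero => simp; ring
  | succ n ih =>
    rw [Finset.sum_range_succ, mul_add, ih]
    push_cast
    ring

theorem norm_iteratedDeriv_one_sub_sq_mul_fejerSum_le (n k : ℕ) {z : ℂ}
    (hz : z ∈ ball (0 : ℂ) 1) :
    ‖iteratedDeriv (k + 1) (fun z => (1 - z) * ((1 - z) * fejerSum n z)) z‖ ≤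
      2 * ((n : ℝ) + 2) ^ (k + 1) := by
  simp only [one_sub_sq_mul_fejerSum]
  rw [iteratedDeriv_fun_add (by fun_prop) (by fun_prop),
    iteratedDeriv_fun_sub (by fun_prop) (by fun_prop), iteratedDeriv_const_mul_field,
    iteratedDeriv_const_mul_field, iteratedDeriv_pow 0, Nat.zero_descFactorial_succ]
  have h1 := norm_iteratedDeriv_pow_le (i := 1) (N := 1) le_rfl (k + 1) hz
  have h2 := norm_iteratedDeriv_pow_le (i := n + 2) (N := n + 2) le_rfl (k + 1) hz
  have h3 : ‖(n : ℂ) + 2‖ = (n : ℝ) + 2 := by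
    rw [← Nat.cast_ofNat, ← Nat.cast_add, Complex.norm_natCast]; push_cast; rfl
  have h4 : (n : ℝ) + 2 ≤ ((n : ℝ) + 2) ^ (k + 1) := le_self_pow₀ (by linarith) (by omega)
  push_cast at h1 h2
  rw [one_pow] at h1
  rw [Nat.cast_zero, zero_mul, mul_zero, zero_sub]
  refine (norm_add_le _ _).trans ?_
  rw [norm_neg, norm_mul, h3]
  nlinarith

/-- Moving a factor `1 - z` inside the derivative costs one derivative of lower order. -/
theorem one_sub_mul_iteratedDeriv {f : ℂ → ℂ} (hf : DifferentiableOn ℂ f (ball 0 1)) (k : ℕ)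
    {z : ℂ} (hz : z ∈ ball (0 : ℂ) 1) :
    (1 - z) * iteratedDeriv (k + 1) f z =
      iteratedDeriv (k + 1) (fun z => (1 - z) * f z) z + ((k : ℂ) + 1) * iteratedDeriv k f z := by
  have h : (fun z => (1 - z) * f z) = fun z => f z - z * f z := by
    funext z; ring
  have hzf : DifferentiableOn ℂ (fun z => z * f z) (ball 0 1) := differentiableOn_id.fun_mul hf
  rw [h, iteratedDeriv_fun_sub (contDiffAt hf hz _)
    (contDiffAt hzf hz _), iteratedDeriv_id_mul hf k hz]
  ring

theorem differentiable_fejerSum (n : ℕ) : Differentiable ℂ (fejerSum n) := by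
  unfold fejerSum
  fun_prop

theorem norm_natCast_add_one (k : ℕ) : ‖(k : ℂ) + 1‖ = (k : ℝ) + 1 := by
  rw [← Nat.cast_add_one, Complex.norm_natCast, Nat.cast_add_one]

theorem norm_one_sub_mul_iteratedDeriv_fejerSum_le (n k : ℕ) {z : ℂ} (hz : z ∈ ball (0 : ℂ) 1) :
    ‖(1 - z) * iteratedDeriv k (fejerSum n) z‖ ≤ ((k : ℝ) + 2) * ((n : ℝ) + 2) ^ (k + 1) := by
  cases k with
  | zero => simpa using norm_iteratedDeriv_one_sub_mul_fejerSum_le n 0 hz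
  | succ k =>
    rw [one_sub_mul_iteratedDeriv (differentiable_fejerSum n).differentiableOn k hz]
    refine (norm_add_le _ _).trans ?_
    rw [norm_mul, norm_natCast_add_one]
    have h1 := norm_iteratedDeriv_one_sub_mul_fejerSum_le n (k + 1) hz
    have h2 := mul_le_mul_of_nonneg_left (norm_iteratedDeriv_fejerSum_le n k hz)
      (by positivity : (0 : ℝ) ≤ (k : ℝ) + 1)
    push_cast
    linarith

/-- Two factors `1 - z` gain two powers of `n` over the trivial bound for the derivatives. -/
theorem norm_one_sub_sq_mul_iteratedDeriv_fejerSum_le (n k : ℕ) {z : ℂ}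
    (hz : z ∈ ball (0 : ℂ) 1) :
    ‖1 - z‖ ^ 2 * ‖iteratedDeriv (k + 1) (fejerSum n) z‖ ≤
      (((k : ℝ) + 1) * ((k : ℝ) + 4) + 2) * ((n : ℝ) + 2) ^ (k + 1) := by
  have hP := (differentiable_fejerSum n).differentiableOn (s := ball 0 1)
  have hQ : DifferentiableOn ℂ (fun z => (1 - z) * fejerSum n z) (ball 0 1) :=
    (differentiableOn_const (1 : ℂ)).fun_sub differentiableOn_id |>.fun_mul hP
  have e : (1 - z) ^ 2 * iteratedDeriv (k + 1) (fejerSum n) z =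
      iteratedDeriv (k + 1) (fun z => (1 - z) * ((1 - z) * fejerSum n z)) z +
        ((k : ℂ) + 1) * iteratedDeriv k (fun z => (1 - z) * fejerSum n z) z +
        ((k : ℂ) + 1) * ((1 - z) * iteratedDeriv k (fejerSum n) z) := by
    rw [← one_sub_mul_iteratedDeriv hQ k hz, pow_two, mul_assoc,
      one_sub_mul_iteratedDeriv hP k hz]
    ring
  rw [← norm_pow, ← norm_mul, e]
  refine norm_add₃_le.trans ?_
  rw [norm_mul ((k : ℂ) + 1), norm_mul ((k : ℂ) + 1), norm_natCast_add_one]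
  have h1 := norm_iteratedDeriv_one_sub_sq_mul_fejerSum_le n k hz
  have hk : (0 : ℝ) ≤ (k : ℝ) + 1 := by positivity
  have h2 := mul_le_mul_of_nonneg_left (norm_iteratedDeriv_one_sub_mul_fejerSum_le n k hz) hk
  have h3 := mul_le_mul_of_nonneg_left (norm_one_sub_mul_iteratedDeriv_fejerSum_le n k hz) hk
  linarith

/-- The derivative of order `k + 1` is dominated by a multiple of `|1 - s z|⁻²` with
`s = 1 - 1 / (n + 2)`, whose means are at most `n + 2`. -/
theorem norm_iteratedDeriv_fejerSum_le_inv (n k : ℕ) {z : ℂ} (hz : z ∈ ball (0 : ℂ) 1) :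
    ‖iteratedDeriv (k + 1) (fejerSum n) z‖ ≤
      2 * (((k : ℝ) + 1) * ((k : ℝ) + 4) + 3) * ((n : ℝ) + 2) ^ (k + 1) *
        (‖1 - (1 - ((n : ℂ) + 2)⁻¹) * z‖ ^ 2)⁻¹ := by
  set N : ℝ := (n : ℝ) + 2 with hN
  have hNpos : 0 < N := by positivity
  have hNc : (n : ℂ) + 2 = (N : ℂ) := by rw [hN]; push_cast; rfl
  have hz1 : ‖z‖ ≤ 1 := by simpa using ball_subset_closedBall hz
  have hw : ‖1 - ((n : ℂ) + 2)⁻¹‖ ≤ 1 := by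
    rw [hNc, ← Complex.ofReal_inv, ← Complex.ofReal_one, ← Complex.ofReal_sub, Complex.norm_real,
      Real.norm_eq_abs, abs_le]
    have h1 : N⁻¹ ≤ 1 := inv_le_one_of_one_le₀ (by linarith [Nat.cast_nonneg (α := ℝ) n])
    have h2 : 0 < N⁻¹ := by positivity
    constructor <;> linarith
  have hne := one_sub_mul_ne_zero hw hz
  set G := ‖iteratedDeriv (k + 1) (fejerSum n) z‖
  have hG0 : 0 ≤ G := norm_nonneg _
  have h1 := norm_one_sub_sq_mul_iteratedDeriv_fejerSum_le n k hz
  have h2 := norm_iteratedDeriv_fejerSum_le n (k + 1) hz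
  have h3 : ‖1 - (1 - ((n : ℂ) + 2)⁻¹) * z‖ ≤ ‖1 - z‖ + N⁻¹ := by
    have e : 1 - (1 - ((n : ℂ) + 2)⁻¹) * z = (1 - z) + ((n : ℂ) + 2)⁻¹ * z := by ring
    rw [e]
    refine (norm_add_le _ _).trans ?_
    rw [norm_mul, hNc, norm_inv, Complex.norm_real, Real.norm_of_nonneg hNpos.le]
    have := mul_le_of_le_one_right (inv_nonneg.mpr hNpos.le) hz1
    linarith
  have h4 : ‖1 - (1 - ((n : ℂ) + 2)⁻¹) * z‖ ^ 2 ≤ 2 * (‖1 - z‖ ^ 2 + (N⁻¹) ^ 2) :=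
    (pow_le_pow_left₀ (norm_nonneg _) h3 2).trans (add_sq_le)
  have h5 : (N⁻¹) ^ 2 * G ≤ N ^ (k + 1) := by
    rw [inv_pow, inv_mul_le_iff₀ (by positivity), ← pow_add, add_comm 2]
    exact h2
  rw [← div_eq_mul_inv, le_div_iff₀ (by positivity)]
  calc G * ‖1 - (1 - ((n : ℂ) + 2)⁻¹) * z‖ ^ 2 ≤ G * (2 * (‖1 - z‖ ^ 2 + (N⁻¹) ^ 2)) := by gcongr
    _ = 2 * (‖1 - z‖ ^ 2 * G + (N⁻¹) ^ 2 * G) := by ring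
    _ ≤ 2 * ((((k : ℝ) + 1) * ((k : ℝ) + 4) + 2) * N ^ (k + 1) + N ^ (k + 1)) := by
        gcongr
    _ = _ := by ring

/-- The symbol of the Cesàro mean of order two is a multiplier with bound of order `n ^ r`. -/
theorem isMultiplier_fejerSum (r n : ℕ) {lam : ℂ} (hlam : ‖lam‖ = 1) :
    IsMultiplier r (8 * (((r : ℝ) + 1) * ((r : ℝ) + 4) + 3) * ((n : ℝ) + 2) ^ r)
      fun z => 2 / (((n : ℂ) + 1) * ((n : ℂ) + 2)) * fejerSum n (lam * z) := by
  set N : ℝ := (n : ℝ) + 2 with hN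
  have hNpos : 0 < N := by positivity
  have hN1 : 1 ≤ N := by linarith [Nat.cast_nonneg (α := ℝ) n]
  have hNc : (n : ℂ) + 2 = (N : ℂ) := by rw [hN]; push_cast; rfl
  set A : ℝ := ((r : ℝ) + 1) * ((r : ℝ) + 4) + 3 with hA
  have hA1 : 1 ≤ A := by rw [hA]; nlinarith [Nat.cast_nonneg (α := ℝ) r]
  have hP := differentiable_fejerSum n
  have hc : ‖2 / (((n : ℂ) + 1) * ((n : ℂ) + 2))‖ ≤ 4 / N ^ 2 := by
    rw [norm_div, norm_mul, norm_natCast_add_one, hNc, Complex.norm_real,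
      Real.norm_of_nonneg hNpos.le, div_le_div_iff₀ (by positivity) (by positivity)]
    simp only [Complex.norm_ofNat]
    nlinarith [Nat.cast_nonneg (α := ℝ) n]
  have hD : ∀ k z, iteratedDeriv k
      (fun z => 2 / (((n : ℂ) + 1) * ((n : ℂ) + 2)) * fejerSum n (lam * z)) z =
      2 / (((n : ℂ) + 1) * ((n : ℂ) + 2)) * (lam ^ k * iteratedDeriv k (fejerSum n) (lam * z)) := by
    intro k z
    rw [iteratedDeriv_const_mul_field, iteratedDeriv_comp_const_mul hP.contDiff]
  have hmem : ∀ z ∈ ball (0 : ℂ) 1, lam * z ∈ ball (0 : ℂ) 1 := fun z hz => by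
    simpa [hlam] using hz
  have hnorm : ∀ k z, ‖iteratedDeriv k
      (fun z => 2 / (((n : ℂ) + 1) * ((n : ℂ) + 2)) * fejerSum n (lam * z)) z‖ ≤
      4 / N ^ 2 * ‖iteratedDeriv k (fejerSum n) (lam * z)‖ := by
    intro k z
    rw [hD, norm_mul, norm_mul, norm_pow, hlam, one_pow, one_mul]
    gcongr
  have hd : DifferentiableOn ℂ
      (fun z => 2 / (((n : ℂ) + 1) * ((n : ℂ) + 2)) * fejerSum n (lam * z)) (ball 0 1) :=
    ((hP.comp (differentiable_id.const_mul lam)).const_mul _).differentiableOn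
  refine ⟨hd, fun k hk z hz => ?_, fun ρ hρ => ?_⟩
  · refine (hnorm k z).trans ?_
    have h1 := norm_iteratedDeriv_fejerSum_le n k (hmem z hz)
    calc 4 / N ^ 2 * ‖iteratedDeriv k (fejerSum n) (lam * z)‖ ≤ 4 / N ^ 2 * N ^ (k + 2) := by
          gcongr
      _ = 4 * N ^ k := by rw [pow_add]; field_simp
      _ ≤ 8 * A * N ^ r := by
          gcongr
          linarith
  · set w : ℂ := (1 - ((n : ℂ) + 2)⁻¹) * lam with hw
    have hwn : ‖w‖ = 1 - N⁻¹ := by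
      rw [hw, norm_mul, hlam, mul_one, hNc, ← Complex.ofReal_inv, ← Complex.ofReal_one,
        ← Complex.ofReal_sub, Complex.norm_real, Real.norm_of_nonneg]
      have := inv_le_one_of_one_le₀ hN1
      linarith
    have hNinv : 0 < N⁻¹ := by positivity
    have hw1 : ‖w‖ < 1 := by linarith
    refine (mean_le_of_norm_le
      (h := fun z => (4 / N ^ 2 * (2 * A * N ^ (r + 1))) • (‖1 - w * z‖ ^ 2)⁻¹)
      (differentiableOn_iteratedDeriv hd _) hρ
      (circleIntegrable_inv_norm_sq hw1.le hρ).const_fun_smul fun z hz => ?_).trans ?_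
    · refine (hnorm (r + 1) z).trans ?_
      have h1 := norm_iteratedDeriv_fejerSum_le_inv n r (hmem z hz)
      rw [← mul_assoc (1 - ((n : ℂ) + 2)⁻¹)] at h1
      rw [smul_eq_mul, mul_assoc (4 / N ^ 2)]
      gcongr
    · rw [Real.circleAverage_fun_smul, smul_eq_mul]
      have h2 := circleAverage_inv_norm_sq_le hw1 hρ
      rw [hwn, sub_sub_cancel, inv_inv] at h2
      calc 4 / N ^ 2 * (2 * A * N ^ (r + 1)) *
            Real.circleAverage (fun z => (‖1 - w * z‖ ^ 2)⁻¹) 0 ρ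
          ≤ 4 / N ^ 2 * (2 * A * N ^ (r + 1)) * N := by gcongr
        _ = 8 * A * N ^ r := by
          rw [pow_succ]
          field_simp
          ring

theorem finsetSum_apply {ι : Type*} (s : Finset ι) (f : ι → ShieldsSpace r) (z : ℂ) :
    (∑ i ∈ s, f i : ShieldsSpace r) z = ∑ i ∈ s, f i z := by
  classical
  induction s using Finset.induction_on with
  | empty => rfl
  | insert a s ha ih =>
    rw [Finset.sum_insert ha, Finset.sum_insert ha, ← ih]
    rfl

theorem smul_Mz_pow_apply (lam : ℂ) (i : ℕ) (f : ShieldsSpace r) (z : ℂ) :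
    ((lam • Mz r) ^ i) f z = (lam * z) ^ i * f z := by
  induction i with
  | zero => simp
  | succ i ih =>
    have h : ((lam • Mz r) ^ (i + 1)) f z = lam * (z * ((lam • Mz r) ^ i) f z) := by
      rw [pow_succ']
      rfl
    rw [h, ih]
    ring

theorem cesaroMean_two_apply (lam : ℂ) (n : ℕ) (f : ShieldsSpace r) (z : ℂ) :
    cesaroMean (lam • Mz r) 2 n f z =
      2 / (((n : ℂ) + 1) * ((n : ℂ) + 2)) * fejerSum n (lam * z) * f z := by
  have h : ∀ (c : ℂ) (g : ShieldsSpace r), (c • g) z = c * g z := fun _ _ => rfl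
  rw [cesaroMean_two, smul_apply, h, mul_assoc]
  congr 1
  rw [fejerSum, Finset.sum_mul, sum_apply, finsetSum_apply]
  refine Finset.sum_congr rfl fun j _ => ?_
  rw [Finset.sum_mul, sum_apply, finsetSum_apply]
  exact Finset.sum_congr rfl fun i _ => smul_Mz_pow_apply lam i f z

/-- The bound `(n + 2) ^ r` holds for `n = 0` as well, which the induction on the order needs. -/
theorem norm_cesaroMean_le (r : ℕ) {p : ℕ} (hp : 2 ≤ p) (n : ℕ) {lam : ℂ} (hlam : ‖lam‖ = 1) :
    ‖cesaroMean (lam • Mz r) p n‖ ≤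
      multiplierConst r * (8 * (((r : ℝ) + 1) * ((r : ℝ) + 4) + 3) * ((n : ℝ) + 2) ^ r) := by
  induction p, hp using Nat.le_induction generalizing n with
  | base =>
    exact (isMultiplier_fejerSum r n hlam).norm_le_of_apply fun f z _ =>
      cesaroMean_two_apply lam n f z
  | succ p _ ih =>
    refine norm_cesaroMean_succ_le _ fun j hj => (ih j).trans ?_
    have h1 : (j : ℝ) ≤ n := by exact_mod_cast hj
    have h2 := multiplierConst_nonneg r
    gcongr

theorem exists_norm_smul_cesaroMean_le (r p : ℕ) (hp : 2 ≤ p) :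
    ∃ C : ℝ, ∀ n : ℕ, 1 ≤ n → ∀ lam : ℂ, ‖lam‖ = 1 →
      ‖((n : ℂ) ^ r)⁻¹ • cesaroMean (lam • Mz r) p n‖ ≤ C := by
  refine ⟨multiplierConst r * (8 * (((r : ℝ) + 1) * ((r : ℝ) + 4) + 3) * 3 ^ r),
    fun n hn lam hlam => ?_⟩
  have hn' : (1 : ℝ) ≤ n := by exact_mod_cast hn
  have h2 := multiplierConst_nonneg r
  rw [norm_smul, norm_inv, norm_pow, Complex.norm_natCast, inv_mul_le_iff₀ (by positivity)]
  refine (norm_cesaroMean_le r hp n hlam).trans ?_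
  calc multiplierConst r * (8 * (((r : ℝ) + 1) * ((r : ℝ) + 4) + 3) * ((n : ℝ) + 2) ^ r)
      ≤ multiplierConst r * (8 * (((r : ℝ) + 1) * ((r : ℝ) + 4) + 3) * (3 * (n : ℝ)) ^ r) := by
        gcongr
        linarith
    _ = _ := by rw [mul_pow]; ring

end ShieldsSpace

/-! ### Lower bounds on the orbit of the constant function -/

namespace DiscHardy

open Metric Set Filter Topology

/-- Hardy's inequality for a polynomial of degree at most `N`, read from the leading coefficient
downwards: reversing the order of the coefficients does not change the modulus on the circle. -/
theorem sum_div_le_pi_mul_mean {N : ℕ} {a : ℕ → ℝ} (ha : ∀ k, 0 ≤ a k) {ρ : ℝ} (hρ : 0 ≤ ρ) :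
    ∑ k ∈ Finset.range (N + 1), a k * ρ ^ k / ((N : ℝ) + 1 - k) ≤
      Real.pi * mean (fun z => ∑ k ∈ Finset.range (N + 1), (a k : ℂ) * z ^ k) ρ := by
  set q : ℂ → ℂ := fun z => ∑ k ∈ Finset.range (N + 1), (a k : ℂ) * z ^ k with hq
  set c : ℕ → ℂ := fun k => ((k : ℂ) - (N + 1)) * Complex.I with hc
  have hkN : ∀ k ∈ Finset.range (N + 1), (k : ℂ) - (N + 1) ≠ 0 := fun k hk h => by
    have h1 : (k : ℂ) = ((N + 1 : ℕ) : ℂ) := by push_cast; exact sub_eq_zero.mp h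
    have h2 : k = N + 1 := by exact_mod_cast h1
    have := Finset.mem_range.mp hk
    omega
  have hcne : ∀ k ∈ Finset.range (N + 1), c k ≠ 0 := fun k hk =>
    mul_ne_zero (hkN k hk) Complex.I_ne_zero
  have hexp : ∀ k, Complex.exp (c k * ((2 * Real.pi : ℝ) : ℂ)) = 1 := fun k => by
    have := Complex.exp_int_mul_two_pi_mul_I ((k : ℤ) - (N + 1))
    rw [← this]
    congr 1
    rw [hc]
    push_cast
    ring
  -- a primitive of `i e^{-i (N + 1) t} q(ρ e^{it})` with vanishing integral over the period
  set U : ℝ → ℂ := fun t => ∑ k ∈ Finset.range (N + 1),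
    ((a k * ρ ^ k : ℝ) : ℂ) / ((k : ℂ) - (N + 1)) * Complex.exp (c k * t) with hU
  set U' : ℝ → ℂ := fun t => ∑ k ∈ Finset.range (N + 1),
    ((a k * ρ ^ k : ℝ) : ℂ) / ((k : ℂ) - (N + 1)) * (Complex.exp (c k * t) * c k) with hU'
  have hder : ∀ t, HasDerivAt U (U' t) t := fun t => by
    refine HasDerivAt.fun_sum fun k _ => HasDerivAt.const_mul _ ?_
    have h1 : HasDerivAt (fun t : ℝ => c k * (t : ℂ)) (c k) t := by
      simpa using (Complex.ofRealCLM.hasDerivAt (x := t)).const_mul (c k)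
    exact h1.cexp
  have hcont : Continuous U' := by rw [hU']; fun_prop
  have hper : U (2 * Real.pi) = U 0 := by
    simp only [hU]
    refine Finset.sum_congr rfl fun k _ => ?_
    rw [hexp]
    simp
  have hint : (∫ t in (0 : ℝ)..2 * Real.pi, U t) = 0 := by
    simp only [hU]
    rw [intervalIntegral.integral_finsetSum fun k _ =>
      Continuous.intervalIntegrable (by fun_prop) _ _]
    refine Finset.sum_eq_zero fun k hk => ?_
    rw [intervalIntegral.integral_const_mul, integral_exp_mul_complex (hcne k hk), hexp]
    simp
  have hnorm : ∀ t, ‖U' t‖ = ‖q (circleMap 0 ρ t)‖ := fun t => by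
    have e : U' t = Complex.I * Complex.exp ((-(((N : ℝ) + 1) * t) : ℝ) * Complex.I) *
        q (circleMap 0 ρ t) := by
      simp only [hU', hq, Finset.mul_sum]
      refine Finset.sum_congr rfl fun k hk => ?_
      have h1 : Complex.exp (c k * t) = Complex.exp ((-(((N : ℝ) + 1) * t) : ℝ) * Complex.I) *
          Complex.exp (t * Complex.I) ^ k := by
        rw [← Complex.exp_nat_mul, ← Complex.exp_add]
        congr 1
        rw [hc]
        push_cast
        ring
      rw [h1, circleMap_zero, mul_pow, hc]
      have := hkN k hk
      push_cast
      field_simp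
    rw [e, norm_mul, norm_mul, Complex.norm_I, Complex.norm_exp_ofReal_mul_I, one_mul, one_mul]
  have hU0 : U 0 = -((∑ k ∈ Finset.range (N + 1), a k * ρ ^ k / ((N : ℝ) + 1 - k) : ℝ) : ℂ) := by
    simp only [hU]
    push_cast
    rw [← Finset.sum_neg_distrib]
    refine Finset.sum_congr rfl fun k _ => ?_
    rw [mul_zero, Complex.exp_zero, mul_one, ← neg_sub ((N : ℂ) + 1), div_neg]
  have key := norm_two_pi_mul_sub_integral_le hder hcont hper
  simp only [hnorm] at key
  have hpos : 0 ≤ ∑ k ∈ Finset.range (N + 1), a k * ρ ^ k / ((N : ℝ) + 1 - k) := by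
    refine Finset.sum_nonneg fun k hk => div_nonneg (mul_nonneg (ha k) (by positivity)) ?_
    have : (k : ℝ) ≤ N := by exact_mod_cast Nat.lt_succ_iff.mp (Finset.mem_range.mp hk)
    linarith
  have h2 : ‖(2 * Real.pi : ℂ)‖ = 2 * Real.pi := by
    rw [← Complex.ofReal_ofNat, ← Complex.ofReal_mul, Complex.norm_real,
      Real.norm_of_nonneg Real.two_pi_pos.le]
  rw [hint, sub_zero, norm_mul, h2, hU0, norm_neg, Complex.norm_real,
    Real.norm_of_nonneg hpos] at key
  unfold mean Real.circleAverage
  rw [smul_eq_mul, mul_left_comm, ← div_eq_inv_mul, le_div_iff₀ Real.two_pi_pos]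
  linarith

/-- The preceding inequality on the unit circle. -/
theorem sum_div_le_pi_mul_h1Norm {N : ℕ} {a : ℕ → ℝ} (ha : ∀ k, 0 ≤ a k) {g : ℂ → ℂ}
    (hg : MemH1 g)
    (hga : EqOn g (fun z => ∑ k ∈ Finset.range (N + 1), (a k : ℂ) * z ^ k) (ball 0 1)) :
    ∑ k ∈ Finset.range (N + 1), a k / ((N : ℝ) + 1 - k) ≤ Real.pi * h1Norm g := by
  have hcont : Continuous fun ρ : ℝ =>
      ∑ k ∈ Finset.range (N + 1), a k * ρ ^ k / ((N : ℝ) + 1 - k) := by fun_prop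
  have hlim := (hcont.tendsto 1).mono_left (nhdsWithin_le_nhds (s := Iio 1))
  simp only [one_pow, mul_one] at hlim
  refine le_of_tendsto hlim ?_
  filter_upwards [Ioo_mem_nhdsLT (zero_lt_one' ℝ)] with ρ hρ
  have hρ' : ρ ∈ Ico (0 : ℝ) 1 := ⟨hρ.1.le, hρ.2⟩
  refine (sum_div_le_pi_mul_mean ha hρ.1.le).trans ?_
  rw [← mean_congr hga hρ']
  exact mul_le_mul_of_nonneg_left (mean_le_h1Norm hg hρ') Real.pi_pos.le

end DiscHardy

namespace ShieldsSpace

open Metric Set Filter Topology DiscHardy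

variable {r : ℕ}

theorem iteratedDeriv_eqOn_of_eqOn {f g : ℂ → ℂ} (h : EqOn f g (ball 0 1)) (k : ℕ) :
    EqOn (iteratedDeriv k f) (iteratedDeriv k g) (ball 0 1) := fun _ hz =>
  (h.eventuallyEq_of_mem (isOpen_ball.mem_nhds hz)).iteratedDeriv_eq k

/-- The constant function `1` on the disc as an element of `X_r`. -/
noncomputable def one (r : ℕ) : ShieldsSpace r :=
  (⟨(ball (0 : ℂ) 1).indicator fun _ => 1, by
    have e : EqOn ((ball (0 : ℂ) 1).indicator fun _ => (1 : ℂ)) (fun _ => 1) (ball 0 1) :=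
      fun z hz => indicator_of_mem hz _
    refine ⟨(differentiableOn_const 1).congr e, fun z hz => indicator_of_notMem hz _,
      MemH1.zero.congr fun z hz => ?_⟩
    rw [iteratedDeriv_eqOn_of_eqOn e (r + 1) hz, iteratedDeriv_const]
    simp⟩ : submodule r)

theorem one_apply {z : ℂ} (hz : z ∈ ball (0 : ℂ) 1) : one r z = 1 :=
  indicator_of_mem (f := fun _ => (1 : ℂ)) hz

theorem Mz_pow_apply (n : ℕ) (f : ShieldsSpace r) (z : ℂ) : (Mz r ^ n) f z = z ^ n * f z := by
  have h := smul_Mz_pow_apply 1 n f z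
  rwa [one_smul, one_mul] at h

/-- A lower bound for the norm of a polynomial in `X_r`: its derivative of order `r + 1` obeys
Hardy's inequality. -/
theorem sum_descFactorial_div_le {N : ℕ} {a : ℕ → ℝ} (ha : ∀ k, 0 ≤ a k) {g : ShieldsSpace r}
    (hg : EqOn g (fun z => ∑ j ∈ Finset.range (r + 1 + (N + 1)), (a j : ℂ) * z ^ j) (ball 0 1)) :
    ∑ k ∈ Finset.range (N + 1),
      a (r + 1 + k) * (r + 1 + k).descFactorial (r + 1) / ((N : ℝ) + 1 - k) ≤
      Real.pi * ‖g‖ := by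
  refine (sum_div_le_pi_mul_h1Norm (g := iteratedDeriv (r + 1) g)
    (a := fun k => a (r + 1 + k) * (r + 1 + k).descFactorial (r + 1))
    (fun k => mul_nonneg (ha _) (Nat.cast_nonneg _)) g.memH1 fun z hz => ?_).trans
    (mul_le_mul_of_nonneg_left g.h1Norm_le_norm Real.pi_pos.le)
  rw [iteratedDeriv_eqOn_of_eqOn hg (r + 1) hz, iteratedDeriv_fun_sum fun j _ => by fun_prop,
    Finset.sum_range_add, Finset.sum_eq_zero, zero_add]
  · refine Finset.sum_congr rfl fun k _ => ?_
    rw [iteratedDeriv_const_mul_field, iteratedDeriv_pow, Nat.add_sub_cancel_left]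
    push_cast
    ring
  · intro j hj
    rw [iteratedDeriv_const_mul_field, iteratedDeriv_pow,
      Nat.descFactorial_of_lt (Finset.mem_range.mp hj)]
    simp

theorem pow_le_descFactorial (r k : ℕ) :
    ((k : ℝ) + 1) ^ (r + 1) ≤ (r + 1 + k).descFactorial (r + 1) := by
  have h := Nat.pow_sub_le_descFactorial (r + 1 + k) (r + 1)
  rw [show r + 1 + k + 1 - (r + 1) = k + 1 by omega] at h
  exact_mod_cast h

/-- The orbit of `1` under `M_z` grows like `n ^ (r + 1)`. -/
theorem pow_le_norm_Mz_pow_one (r N : ℕ) :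
    ((N : ℝ) + 1) ^ (r + 1) ≤ Real.pi * ‖(Mz r ^ (r + 1 + N)) (one r)‖ := by
  classical
  have h := sum_descFactorial_div_le (N := N) (a := fun j => if j = r + 1 + N then 1 else 0)
    (fun k => by split_ifs <;> norm_num) (g := (Mz r ^ (r + 1 + N)) (one r)) fun z hz => by
      beta_reduce
      rw [Mz_pow_apply, one_apply hz, mul_one, Finset.sum_eq_single (r + 1 + N)]
      · simp
      · intro j _ hj
        simp [hj]
      · intro h
        exact absurd (Finset.mem_range.mpr (by omega)) h
  rw [Finset.sum_eq_single N] at h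
  · simp only [if_true, one_mul, add_sub_cancel_left, div_one] at h
    exact (pow_le_descFactorial r N).trans h
  · intro k _ hk
    simp [hk]
  · intro h
    exact absurd (Finset.mem_range.mpr (by omega)) h

theorem not_tendsto_Mz_pow_one (r : ℕ) :
    ¬ Tendsto (fun n : ℕ => ‖(Mz r ^ n) (one r)‖ / (n : ℝ) ^ (r + 1)) atTop (𝓝 0) := by
  intro h
  have hpos : (0 : ℝ) < (Real.pi * ((r : ℝ) + 1) ^ (r + 1))⁻¹ := by
    have := Real.pi_pos
    positivity
  obtain ⟨n, hn, hnr⟩ := ((h.eventually_lt_const hpos).and (eventually_ge_atTop (r + 1))).exists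
  obtain ⟨N, rfl⟩ := Nat.exists_eq_add_of_le hnr
  have h1 := pow_le_norm_Mz_pow_one r N
  have hn0 : (0 : ℝ) < ((r + 1 + N : ℕ) : ℝ) := by
    exact_mod_cast (by omega : 0 < r + 1 + N)
  have h2 : ((r + 1 + N : ℕ) : ℝ) ^ (r + 1) ≤ ((r : ℝ) + 1) ^ (r + 1) * ((N : ℝ) + 1) ^ (r + 1) := by
    rw [← mul_pow]
    refine pow_le_pow_left₀ hn0.le ?_ _
    push_cast
    nlinarith [Nat.cast_nonneg (α := ℝ) r, Nat.cast_nonneg (α := ℝ) N,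
      mul_nonneg (Nat.cast_nonneg (α := ℝ) r) (Nat.cast_nonneg (α := ℝ) N)]
  rw [div_lt_iff₀ (by positivity), inv_mul_eq_div, lt_div_iff₀ (inv_pos.mp hpos)] at hn
  have h3 := mul_le_mul_of_nonneg_left h1 (by positivity : (0 : ℝ) ≤ ((r : ℝ) + 1) ^ (r + 1))
  linarith

theorem not_tendsto_smul_Mz_pow_one (r : ℕ) :
    ¬ Tendsto (fun n : ℕ => ((n : ℂ) ^ (r + 1))⁻¹ • (Mz r ^ n) (one r)) atTop (𝓝 0) := by
  intro h
  refine not_tendsto_Mz_pow_one r ?_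
  have h1 := h.norm
  rw [norm_zero] at h1
  refine h1.congr fun n => ?_
  rw [norm_smul, norm_inv, norm_pow, Complex.norm_natCast, inv_mul_eq_div]

theorem not_isLittleO_norm_Mz_pow (r : ℕ) :
    ¬ (fun n : ℕ => ‖Mz r ^ n‖) =o[atTop] (fun n : ℕ => (n : ℝ) ^ (r + 1)) := by
  intro h
  refine not_tendsto_Mz_pow_one r ?_
  have h1 := h.tendsto_div_nhds_zero.mul_const ‖one r‖
  rw [zero_mul] at h1
  refine squeeze_zero (fun n => by positivity) (fun n => ?_) h1
  rw [div_mul_eq_mul_div]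
  gcongr
  exact (Mz r ^ n).le_opNorm (one r)

theorem cesaroMean_one_apply (n : ℕ) (f : ShieldsSpace r) (z : ℂ) :
    cesaroMean (Mz r) 1 n f z = ((n : ℂ) + 1)⁻¹ * ∑ j ∈ Finset.range (n + 1), z ^ j * f z := by
  have h : ∀ (c : ℂ) (g : ShieldsSpace r), (c • g) z = c * g z := fun _ _ => rfl
  rw [cesaroMean_one, smul_apply, h, sum_apply, finsetSum_apply]
  simp only [Mz_pow_apply]

/-- The order-one means of `1` exceed `n ^ r` by a logarithmic factor: the derivative of order
`r + 1` of `∑_{j ≤ n} z^j` has its largest coefficients at the top, where the reversed Hardy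
inequality weights them by the harmonic series. -/
theorem pow_mul_harmonic_le (r m : ℕ) :
    ((m : ℝ) + 1) ^ (r + 1) * ∑ i ∈ Finset.range (m + 1), 1 / ((i : ℝ) + 1) ≤
      Real.pi * (((r + 1 + 2 * m : ℕ) : ℝ) + 1) *
        ‖cesaroMean (Mz r) 1 (r + 1 + 2 * m) (one r)‖ := by
  set n : ℕ := r + 1 + 2 * m with hn
  have hn1 : (0 : ℝ) < (n : ℝ) + 1 := by positivity
  have h := sum_descFactorial_div_le (N := 2 * m) (a := fun _ => ((n : ℝ) + 1)⁻¹)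
    (fun _ => by positivity) (g := cesaroMean (Mz r) 1 n (one r)) fun z hz => by
      rw [cesaroMean_one_apply, Finset.mul_sum]
      refine Finset.sum_congr rfl fun j _ => ?_
      rw [one_apply hz, mul_one]
      push_cast
      rfl
  -- in the reflected sum the index `i` stands for the exponent `n - i`; keep the terms `i ≤ m`
  rw [← Finset.sum_range_reflect] at h
  have hlow : ∑ i ∈ Finset.range (m + 1), ((n : ℝ) + 1)⁻¹ *
      (((m : ℝ) + 1) ^ (r + 1) * (1 / ((i : ℝ) + 1))) ≤
      Real.pi * ‖cesaroMean (Mz r) 1 n (one r)‖ := by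
    refine le_trans ?_ h
    have hterm : ∀ i ∈ Finset.range (2 * m + 1),
        (((2 * m : ℕ) : ℝ) + 1 - ((2 * m + 1 - 1 - i : ℕ) : ℝ)) = (i : ℝ) + 1 := fun i hi => by
      have := Finset.mem_range.mp hi
      rw [Nat.cast_sub (by omega)]
      push_cast [Nat.add_sub_cancel]
      ring
    have hsub : Finset.range (m + 1) ⊆ Finset.range (2 * m + 1) :=
      Finset.range_subset_range.mpr (by omega)
    refine le_trans (Finset.sum_le_sum fun i hi => ?_)
      (Finset.sum_le_sum_of_subset_of_nonneg hsub fun i hi _ => ?_)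
    · rw [hterm i (hsub hi), mul_div_assoc, mul_one_div]
      have h1 := pow_le_descFactorial r (2 * m + 1 - 1 - i)
      have h2 : (m : ℝ) ≤ ((2 * m + 1 - 1 - i : ℕ) : ℝ) := by
        have := Finset.mem_range.mp hi
        exact_mod_cast (by omega : m ≤ 2 * m + 1 - 1 - i)
      have h3 : ((m : ℝ) + 1) ^ (r + 1) ≤
          ((r + 1 + (2 * m + 1 - 1 - i)).descFactorial (r + 1) : ℝ) :=
        (pow_le_pow_left₀ (by positivity) (by linarith) _).trans h1
      gcongr
    · rw [hterm i hi]
      positivity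
  rw [← Finset.mul_sum, ← Finset.mul_sum, inv_mul_le_iff₀ hn1] at hlow
  linarith

theorem not_exists_norm_smul_cesaroMean_one_le (r : ℕ) :
    ¬ ∃ C : ℝ, ∀ n : ℕ, 1 ≤ n → ‖((n : ℂ) ^ r)⁻¹ • cesaroMean (Mz r) 1 n‖ ≤ C := by
  rintro ⟨C, hC⟩
  have hbound : ∀ m : ℕ, ∑ i ∈ Finset.range (m + 1), 1 / ((i : ℝ) + 1) ≤
      Real.pi * ((r : ℝ) + 2) ^ (r + 1) * (C * ‖one r‖) := by
    intro m
    have h1 := pow_mul_harmonic_le r m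
    have h2 := hC (r + 1 + 2 * m) (by omega)
    set n : ℕ := r + 1 + 2 * m with hn
    have hn0 : (0 : ℝ) < n := by exact_mod_cast (by omega : 0 < n)
    have hC0 : 0 ≤ C := (norm_nonneg _).trans h2
    rw [norm_smul, norm_inv, norm_pow, Complex.norm_natCast, inv_mul_le_iff₀ (by positivity)] at h2
    have h3 : ‖cesaroMean (Mz r) 1 n (one r)‖ ≤ (n : ℝ) ^ r * C * ‖one r‖ :=
      ((cesaroMean (Mz r) 1 n).le_opNorm _).trans (by gcongr)
    have h4 : (n : ℝ) + 1 ≤ ((r : ℝ) + 2) * ((m : ℝ) + 1) := by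
      rw [hn]
      push_cast
      nlinarith [mul_nonneg (Nat.cast_nonneg (α := ℝ) r) (Nat.cast_nonneg (α := ℝ) m)]
    have hπ := Real.pi_pos
    have hm : (0 : ℝ) < ((m : ℝ) + 1) ^ (r + 1) := by positivity
    refine le_of_mul_le_mul_left (h1.trans ?_) hm
    calc Real.pi * ((n : ℝ) + 1) * ‖cesaroMean (Mz r) 1 n (one r)‖
        ≤ Real.pi * ((n : ℝ) + 1) * (((n : ℝ) + 1) ^ r * C * ‖one r‖) := by
          refine mul_le_mul_of_nonneg_left (h3.trans ?_) (by positivity)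
          gcongr
          linarith
      _ = Real.pi * ((n : ℝ) + 1) ^ (r + 1) * (C * ‖one r‖) := by ring
      _ ≤ Real.pi * (((r : ℝ) + 2) * ((m : ℝ) + 1)) ^ (r + 1) * (C * ‖one r‖) := by gcongr
      _ = _ := by rw [mul_pow]; ring
  have htend := (tendsto_add_atTop_iff_nat 1).mpr Real.tendsto_sum_range_one_div_nat_succ_atTop
  obtain ⟨m, hm⟩ := (htend.eventually_gt_atTop
    (Real.pi * ((r : ℝ) + 2) ^ (r + 1) * (C * ‖one r‖))).exists
  exact absurd (hbound m) (not_le.mpr hm)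

end ShieldsSpace

/-! ### Growth of the Cesàro means, the powers and the resolvent of `M_z` -/

theorem proposition5p5 (r : ℕ) :
    -- (i)
    (∀ p : ℕ, 2 ≤ p → ∃ C : ℝ, ∀ n : ℕ, 1 ≤ n → ∀ lam : ℂ, ‖lam‖ = 1 →
      ‖((n : ℂ) ^ r)⁻¹ • cesaroMean (lam • ShieldsSpace.Mz r) p n‖ ≤ C) ∧
    -- (ii)
    (¬ ∃ C : ℝ, ∀ n : ℕ, 1 ≤ n →
      ‖((n : ℂ) ^ r)⁻¹ • cesaroMean (ShieldsSpace.Mz r) 1 n‖ ≤ C) ∧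
    -- (iii)
    (¬ ∀ f : ShieldsSpace r, Filter.Tendsto
      (fun n : ℕ => ((n : ℂ) ^ (r + 1))⁻¹ • (ShieldsSpace.Mz r ^ n) f)
      Filter.atTop (nhds 0)) ∧
    -- the resolvent condition holds, but the norms of the powers are not `o(n^(r+1))`
    ((∃ C : ℝ, ∀ μ : ℂ, 1 < ‖μ‖ → μ ∈ resolventSet ℂ (ShieldsSpace.Mz r) ∧
        (‖μ‖ - 1) ^ (r + 1) / ‖μ‖ ^ r * ‖resolvent (ShieldsSpace.Mz r) μ‖ ≤ C) ∧
      ¬ (fun n : ℕ => ‖ShieldsSpace.Mz r ^ n‖) =o[Filter.atTop]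
        (fun n : ℕ => (n : ℝ) ^ (r + 1))) := by
  exact ⟨fun p hp => ShieldsSpace.exists_norm_smul_cesaroMean_le r p hp,
    ShieldsSpace.not_exists_norm_smul_cesaroMean_one_le r,
    fun h => ShieldsSpace.not_tendsto_smul_Mz_pow_one r (h (ShieldsSpace.one r)),
    ⟨_, fun _ hμ => ShieldsSpace.mem_resolventSet_and_norm_resolvent_le r hμ⟩,
    ShieldsSpace.not_isLittleO_norm_Mz_pow r⟩
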